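/- **Setting.** Fix a finite set $\mathcal X$ of marks with $|\mathcal X|\ge 2$ and a degree bound $M\ge 2$. A rooted network $(G,o)$ is a connected graph $G$ with at most countably many vertices, directed or undirected, without loops or multi-edges, in which every vertex has at most $M$ neighbours, together with a mark in $\mathcal X$ at every vertex and a root $o$; networks are regarded up to isomorphism. The graph distance is that of the underlying undirected graph. Let $\mathcal G_*$ be the set of rooted networks, with the $\sigma$-algebra generated by the events that a ball around the root is isomorphic to a given finite rooted network, and let $\mathcal G_\to$ be the set of networks with a distinguished infinite walk $(o_n)_{n\ge1}$, with the $\sigma$-algebra generated by the events that a ball around $o_1$ together with $o_1,\dots,o_n$ is isomorphic to a given finite network with a walk of length $n$. For a probability law $\mu$ on $\mathcal G_*$ let $\mu_\to$ be the law on $\mathcal G_\to$ of $(G,(O_n)_{n\ge1})$, where $(G,o)\sim\mu$ and $(O_n)$ is the simple random walk on $G$ with $O_1=o$ (it moves to a uniformly chosen neighbour, along the arcs if the graph is directed, and stays where it is if there is none). The law $\mu$ is *stationary ergodic* if $\mu_\to$ is invariant and ergodic for the shift $\theta(G,(o_n)_{n\ge1})=(G,(o_{n+1})_{n\ge1})$.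 For a joint law $\rho$ of a pair of rooted networks, $\rho_\to$ is defined by running, given the pair, two independent simple random walks, and $\rho$ is *stationary ergodic* if $\rho_\to$ is invariant and ergodic for $\theta\times\theta$. **Tests.** Fix a non-decreasing $k:\mathbb N\to\mathbb N$ with $k(n)\to\infty$. The sample $S_n$ of a network with a walk is the subnetwork induced on all vertices at distance at most $k(n)$ from $\{O_1,\dots,O_n\}$, together with $O_1,\dots,O_n$, up to isomorphism. A test for pairs is a family $(\psi^\alpha)_{\alpha\in(0,1)}$ of $\{0,1\}$-valued functions of two such samples. It is *consistent* for $H_0$ against $H_1$ (sets of laws of pairs) if for all $\alpha\in(0,1)$: $\rho_\to(\psi^\alpha(S_n,S_n')=1)\le\alpha$ for all $\rho\in H_0$ and $n\ge1$; and $\rho_\to\bigl(\lim_{n\to\infty}\psi^\alpha(S_n,S_n')=1\bigr)=1$ for all $\rho\in H_1$. Here $S_n,S_n'$ are the samples of the two networks. **Proposition.** Let $\mathcal U\subseteq\mathcal G_*$ be any class of rooted networks that contains all undirected bi-infinite paths with marks in $\mathcal X$ (for instance all rooted networks, all infinite ones, all undirected ones, or only the marked bi-infinite paths). Consider only laws under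 which the networks belong to $\mathcal U$ almost surely. Then there is no consistent test 1. for homogeneity of two independent random networks, that is, of $H_0=\{\mu\otimes\mu\}$ against $H_1=\{\mu\otimes\nu:\mu\ne\nu\}$, where $\mu,\nu$ range over the stationary ergodic laws; 2. for homogeneity of a jointly distributed pair, that is, of the set of stationary ergodic laws $\rho$ of pairs whose two marginals are equal against the set of those whose marginals differ; 3. for independence, that is, of the set of stationary ergodic laws $\rho$ of pairs that are the product of their marginals against the set of those that are not. -/

import Mathlib

open MeasureTheory ProbabilityTheory Filter Set

/-- A network with marks in `X`: an at most countable vertex set (realised as a set of natural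
numbers; labels never matter, see `Net.Iso`), a relation `arc` without loops, and a mark for every
vertex (values of `mark` outside `verts` are irrelevant). Undirected networks are those whose
relation `arc` is symmetric. -/
structure Net (X : Type*) where
  verts : Set ℕ
  arc : ℕ → ℕ → Prop
  mark : ℕ → X
  arc_mem : ∀ u v, arc u v → u ∈ verts ∧ v ∈ verts
  arc_irrefl : ∀ v, ¬ arc v v

namespace Net

variable {X : Type*}

/-- Isomorphism of networks with distinguished vertices `p`, respectively `q`. -/
def Iso (G H : Net X) {ι : Type} (p q : ι → ℕ) : Prop :=
  ∃ f : G.verts ≃ H.verts,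
    (∀ u v : G.verts, G.arc u v ↔ H.arc (f u) (f v)) ∧
    (∀ u : G.verts, G.mark u = H.mark (f u)) ∧
    (∀ (u : G.verts) (i : ι), (u : ℕ) = p i ↔ (f u : ℕ) = q i)

/-- The subnetwork induced on a set of vertices. -/
def induce (G : Net X) (A : Set ℕ) : Net X where
  verts := G.verts ∩ A
  arc u v := u ∈ A ∧ v ∈ A ∧ G.arc u v
  mark := G.mark
  arc_mem u v h := ⟨⟨(G.arc_mem u v h.2.2).1, h.1⟩, ⟨(G.arc_mem u v h.2.2).2, h.2.1⟩⟩
  arc_irrefl v h := G.arc_irrefl v h.2.2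

/-- The underlying undirected graph; it supplies the graph distance. -/
def graph (G : Net X) : SimpleGraph ℕ := SimpleGraph.fromRel G.arc

/-- The vertices at graph distance at most `r` from `o`. -/
def ball (G : Net X) (o r : ℕ) : Set ℕ := {v | v ∈ G.verts ∧ G.graph.edist o v ≤ (r : ℕ∞)}

/-- Connected, and every vertex has at most `M` neighbours. -/
structure IsAdmissible (G : Net X) (M : ℕ) : Prop where
  degree_le : ∀ v ∈ G.verts, {w | G.arc v w ∨ G.arc w v}.encard ≤ (M : ℕ∞)
  connected : ∀ u ∈ G.verts, ∀ v ∈ G.verts, G.graph.Reachable u v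

open scoped Classical in
/-- One step of the simple random walk: the next vertex is uniform among the neighbours
(out-neighbours, if the network is directed) of `v`; if there are none, the walk stays at `v`. -/
noncomputable def stepPMF (G : Net X) (v : ℕ) : PMF ℕ :=
  if h : {w | G.arc v w}.Finite ∧ {w | G.arc v w}.Nonempty then
    PMF.uniformOfFinset h.1.toFinset (h.1.toFinset_nonempty.2 h.2)
  else PMF.pure v

/-- The one-step transition kernel at time `n`, as a function of the whole past. -/
noncomputable def stepKernel (G : Net X) (n : ℕ) : Kernel ((_i : Finset.Iic n) → ℕ) ℕ where
  toFun h := (G.stepPMF (h ⟨n, Finset.mem_Iic.2 le_rfl⟩)).toMeasure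
  measurable' :=
    (measurable_from_top (f := fun v : ℕ => (G.stepPMF v).toMeasure)).comp
      (measurable_pi_apply (⟨n, Finset.mem_Iic.2 le_rfl⟩ : Finset.Iic n))

instance (G : Net X) (n : ℕ) : IsMarkovKernel (G.stepKernel n) :=
  ⟨fun h => PMF.toMeasure.isProbabilityMeasure (G.stepPMF (h ⟨n, Finset.mem_Iic.2 le_rfl⟩))⟩

/-- The law, on sequences of vertices, of the simple random walk on `G` started at `o`. -/
noncomputable def srw (G : Net X) (o : ℕ) : Measure (ℕ → ℕ) :=
  Kernel.traj (X := fun _ => ℕ) G.stepKernel 0 (fun _ => o)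

/-- The infinite walks on `G` (with the convention that a walk stays at a vertex it cannot
leave). -/
def walks (G : Net X) : Set (ℕ → ℕ) :=
  {s | (∀ i, s i ∈ G.verts) ∧
    ∀ i, G.arc (s i) (s (i + 1)) ∨ ((∀ w, ¬ G.arc (s i) w) ∧ s (i + 1) = s i)}

end Net

/-- Rooted connected networks with marks in `X` and degrees at most `M`. -/
structure RootedNetwork (X : Type*) (M : ℕ) extends Net X where
  admissible : toNet.IsAdmissible M
  root : ℕ
  root_mem : root ∈ verts

/-- Connected networks with marks in `X`, degrees at most `M`, and a distinguished infinite walk,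
whose first vertex is the root. -/
structure WalkNetwork (X : Type*) (M : ℕ) extends Net X where
  admissible : toNet.IsAdmissible M
  walk : ℕ → ℕ
  walk_mem : walk ∈ toNet.walks

/-- The set of rooted networks some ball of which around the root is isomorphic to `(g, o)`. -/
def RootedNetwork.cylinder (X : Type*) (M : ℕ) (g : Net X) (o : ℕ) : Set (RootedNetwork X M) :=
  {x | ∃ r : ℕ, (x.toNet.induce (x.toNet.ball x.root r)).Iso g
    (fun _ : Unit => x.root) (fun _ => o)}

/-- The set of networks with a distinguished walk some ball of which around the first vertex,
together with the first `n` vertices of the walk, is isomorphic to `(g, w)`. -/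
def WalkNetwork.cylinder (X : Type*) (M : ℕ) (g : Net X) {n : ℕ} (w : Fin n → ℕ) :
    Set (WalkNetwork X M) :=
  {x | ∃ r : ℕ, (x.toNet.induce (x.toNet.ball (x.walk 0) r)).Iso g
    (fun i : Fin n => x.walk i) w}

/-- The sigma-algebra generated by the sets of rooted networks with a prescribed finite ball around
the root. Its sets are invariant under isomorphism, so probability measures for it are the same as
probability measures on the set of isomorphism classes. -/
instance (X : Type*) (M : ℕ) : MeasurableSpace (RootedNetwork X M) :=
  MeasurableSpace.generateFrom
    {A | ∃ (g : Net X) (o : ℕ), g.verts.Finite ∧ o ∈ g.verts ∧ A = RootedNetwork.cylinder X M g o}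

/-- The sigma-algebra generated by the sets of networks with a distinguished walk that have a
prescribed finite ball with a prescribed finite initial piece of the walk. -/
instance (X : Type*) (M : ℕ) : MeasurableSpace (WalkNetwork X M) :=
  MeasurableSpace.generateFrom
    {A | ∃ (g : Net X) (n : ℕ) (w : Fin (n + 1) → ℕ),
      g.verts.Finite ∧ (∀ i, w i ∈ g.verts) ∧ A = WalkNetwork.cylinder X M g w}

section Laws

variable {X : Type*} {M : ℕ}

/-- The shift `(G, (o₁, o₂, …)) ↦ (G, (o₂, o₃, …))`. -/
def WalkNetwork.shift (x : WalkNetwork X M) : WalkNetwork X M where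
  toNet := x.toNet
  admissible := x.admissible
  walk i := x.walk (i + 1)
  walk_mem := ⟨fun i => x.walk_mem.1 (i + 1), fun i => x.walk_mem.2 (i + 1)⟩

/-- The law of `x` together with a simple random walk on it started at the root. (The walk is almost
surely a member of `x.toNet.walks`.) -/
noncomputable def RootedNetwork.walkLaw (x : RootedNetwork X M) : Measure (WalkNetwork X M) :=
  ((x.toNet.srw x.root).comap ((↑) : x.toNet.walks → (ℕ → ℕ))).map
    (fun s => ⟨x.toNet, x.admissible, s.1, s.2⟩)

/-- The law of the network with a simple random walk on it, when the rooted network is drawn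
from `μ`. -/
noncomputable def withWalk (μ : Measure (RootedNetwork X M)) : Measure (WalkNetwork X M) :=
  μ.bind RootedNetwork.walkLaw

/-- The same for a pair of rooted networks with joint law `ρ`; given the pair, the two walks are
independent. -/
noncomputable def pairWithWalks (ρ : Measure (RootedNetwork X M × RootedNetwork X M)) :
    Measure (WalkNetwork X M × WalkNetwork X M) :=
  ρ.bind (fun p => p.1.walkLaw.prod p.2.walkLaw)

/-- Stationary ergodic laws of a rooted network that are carried by the class `U`. (Mathlib's
`Ergodic` includes invariance of the measure.) -/
def ergodicLaws (U : Set (RootedNetwork X M)) : Set (Measure (RootedNetwork X M)) :=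
  {μ | IsProbabilityMeasure μ ∧ Ergodic WalkNetwork.shift (withWalk μ) ∧ ∀ᵐ x ∂μ, x ∈ U}

/-- Joint laws of pairs of rooted networks of the class `U` that are jointly stationary and
ergodic. -/
def ergodicPairLaws (U : Set (RootedNetwork X M)) :
    Set (Measure (RootedNetwork X M × RootedNetwork X M)) :=
  {ρ | IsProbabilityMeasure ρ ∧
    Ergodic (Prod.map WalkNetwork.shift WalkNetwork.shift) (pairWithWalks ρ) ∧
    ∀ᵐ p ∂ρ, p.1 ∈ U ∧ p.2 ∈ U}

/-- Undirected bi-infinite paths (with arbitrary marks). -/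
def RootedNetwork.IsPath (x : RootedNetwork X M) : Prop :=
  x.verts.Infinite ∧ (∀ u v, x.arc u v → x.arc v u) ∧ ∀ v ∈ x.verts, {w | x.arc v w}.encard = 2

end Laws

section Testing

variable {X : Type*} {M : ℕ}

/-- A network with a distinguished walk of length `n`. -/
structure Sample (X : Type*) (n : ℕ) extends Net X where
  walk : Fin n → ℕ

/-- The sample of size `n`: the subnetwork induced on all vertices at distance at most `k n` from
the first `n` vertices of the walk, together with these `n` vertices. -/
def WalkNetwork.sample (k : ℕ → ℕ) (n : ℕ) (x : WalkNetwork X M) : Sample X n where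
  toNet := x.toNet.induce {v | ∃ i : Fin n, v ∈ x.toNet.ball (x.walk i) (k n)}
  walk i := x.walk i

/-- A test for a pair of networks: a family, indexed by the level `α`, of binary functions of the
pair of samples, regarded up to isomorphism. The answer `true` stands for `H₁`. -/
structure PairTest (X : Type*) where
  answer : ℝ → (n : ℕ) → Sample X n → Sample X n → Bool
  invariant : ∀ (α : ℝ) (n : ℕ) (s s' t t' : Sample X n),
    s.toNet.Iso s'.toNet s.walk s'.walk → t.toNet.Iso t'.toNet t.walk t'.walk →
      answer α n s t = answer α n s' t'

/-- The test `ψ`, applied to the samples with radii `k n`, is consistent for the hypothesis `H₀`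
against `H₁`, which are sets of laws of pairs of rooted networks. -/
structure PairTest.IsConsistent (ψ : PairTest X) (k : ℕ → ℕ)
    (H₀ H₁ : Set (Measure (RootedNetwork X M × RootedNetwork X M))) : Prop where
  typeI : ∀ ρ ∈ H₀, ∀ n : ℕ, 1 ≤ n → ∀ α ∈ Ioo (0 : ℝ) 1,
    pairWithWalks ρ {p | ψ.answer α n (p.1.sample k n) (p.2.sample k n) = true}
      ≤ ENNReal.ofReal α
  typeII : ∀ ρ ∈ H₁, ∀ α ∈ Ioo (0 : ℝ) 1,
    ∀ᵐ p ∂(pairWithWalks ρ),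
      ∀ᶠ n in atTop, ψ.answer α n (p.1.sample k n) (p.2.sample k n) = true

end Testing

/-!
The proof rests on one observation about limits. If laws in the hypothesis look, on every finite
window, like a *non-ergodic* mixture that gives positive weight to an ergodic law of the alternative,
then no test is consistent: at a fixed sample size `n` the sample only depends on a finite window, so
the rejection probability under suitable laws of the hypothesis is at least a fixed multiple of the
one under the law of the alternative, which tends to one; hence small levels cannot be kept. This is
`PairTest.not_isConsistent_of_phases`.

All laws that are needed are laws of marked bi-infinite paths with finitely many possible markings.

* Homogeneity: the hypothesis contains `μ ⊗ μ`, where `μ` is the path with periodic marks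
  `x … x y … y` of long odd period and with a uniform phase. Seen from the root, this is close to the
  mixture of the constant path `x` and the constant path `y`, so `μ ⊗ μ` is close to a mixture in
  which the pair (constant `x`, constant `y`) has weight about one quarter.
* Independence: the hypothesis contains `μ ⊗ μ`, where `μ` has the marks `x y x y … x` of long odd
  period. Locally, `μ ⊗ μ` looks like a pair of alternating paths with independent phases. The walks
  change the phases of alternating paths deterministically, so this pair is not ergodic: it is a
  mixture of the pair with equal phases and the pair with opposite phases. Both are ergodic, and in
  both the two networks are dependent.

Ergodicity is derived from a skew product (`prod_uniformSeq_eq_zero_or_one`): the environment seen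
from the walkers is determined by the phases and by the independent increments of the walks, and a
step of the walks moves the phases. Over a Bernoulli shift such a skew product with a finite fibre is
ergodic as soon as the motion of the phases is transitive; for pairs of phases modulo `N` this holds
because `N` is odd (`reflTransGen_zmod_prod`). Recentring the path at the walker gives an isomorphic
network, not an equal one; this is harmless because measurable sets do not distinguish isomorphic
networks (`WalkNetwork.mem_iff_of_iso`).

The measure theory needs that the shift and the law of the walk depend measurably on the network.
Both reduce to the fact that every isomorphism-invariant property of a ball of given radius is
measurable (`Net.measurableSet_of_ball`), although the generating cylinders leave the radius open.
-/

/-! ### Isomorphisms and balls of networks -/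

namespace Net

variable {X : Type*} {G H K : Net X} {ι : Type}

theorem Iso.refl (G : Net X) (p : ι → ℕ) : G.Iso G p p :=
  ⟨Equiv.refl _, fun _ _ => Iff.rfl, fun _ => rfl, fun _ _ => Iff.rfl⟩

theorem Iso.symm {p q : ι → ℕ} (h : G.Iso H p q) : H.Iso G q p := by
  obtain ⟨f, h1, h2, h3⟩ := h
  refine ⟨f.symm, fun u v => ?_, fun u => ?_, fun u i => ?_⟩
  · simpa using (h1 (f.symm u) (f.symm v)).symm
  · simpa using (h2 (f.symm u)).symm
  · simpa using (h3 (f.symm u) i).symm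

theorem Iso.trans {p q s : ι → ℕ} (h : G.Iso H p q) (h' : H.Iso K q s) : G.Iso K p s := by
  obtain ⟨f, h1, h2, h3⟩ := h
  obtain ⟨f', h1', h2', h3'⟩ := h'
  exact ⟨f.trans f', fun u v => (h1 u v).trans (h1' _ _), fun u => (h2 u).trans (h2' _),
    fun u i => (h3 u i).trans (h3' _ _)⟩

theorem Iso.comp {κ : Type} {p q : ι → ℕ} (h : G.Iso H p q) (φ : κ → ι) :
    G.Iso H (p ∘ φ) (q ∘ φ) := by
  obtain ⟨f, h1, h2, h3⟩ := h
  exact ⟨f, h1, h2, fun u i => h3 u (φ i)⟩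

/-- An isomorphism of induced subnetworks restricts to smaller subnetworks that it matches. -/
theorem iso_induce_of_mem_iff {A A' B B' : Set ℕ} {p q : ι → ℕ}
    (f : (G.induce A).verts ≃ (H.induce B).verts)
    (h1 : ∀ u v : (G.induce A).verts, (G.induce A).arc u v ↔ (H.induce B).arc (f u) (f v))
    (h2 : ∀ u : (G.induce A).verts, (G.induce A).mark u = (H.induce B).mark (f u))
    (h3 : ∀ (u : (G.induce A).verts) (i : ι), (u : ℕ) = p i ↔ (f u : ℕ) = q i)
    (hA : A' ⊆ A) (hB : B' ⊆ B) (h : ∀ u : (G.induce A).verts, (u : ℕ) ∈ A' ↔ (f u : ℕ) ∈ B') :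
    (G.induce A').Iso (H.induce B') p q := by
  have hA' : ∀ u : (G.induce A').verts, (u : ℕ) ∈ (G.induce A).verts :=
    fun u => ⟨u.2.1, hA u.2.2⟩
  have hB' : ∀ u : (H.induce B').verts, (u : ℕ) ∈ (H.induce B).verts :=
    fun u => ⟨u.2.1, hB u.2.2⟩
  refine ⟨⟨fun u => ⟨f ⟨u, hA' u⟩, (f ⟨u, hA' u⟩).2.1, (h ⟨u, hA' u⟩).1 u.2.2⟩,
    fun v => ⟨f.symm ⟨v, hB' v⟩, (f.symm ⟨v, hB' v⟩).2.1,
      (h (f.symm ⟨v, hB' v⟩)).2 (by simpa using v.2.2)⟩, ?_, ?_⟩, ?_, ?_, ?_⟩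
  · intro u; simp
  · intro u; simp
  · intro u v
    have := h1 ⟨u, hA' u⟩ ⟨v, hA' v⟩
    constructor
    · intro huv
      exact ⟨(h ⟨u, hA' u⟩).1 u.2.2, (h ⟨v, hA' v⟩).1 v.2.2,
        (this.1 ⟨hA huv.1, hA huv.2.1, huv.2.2⟩).2.2⟩
    · intro huv
      exact ⟨u.2.2, v.2.2, (this.2 ⟨hB huv.1, hB huv.2.1, huv.2.2⟩).2.2⟩
  · intro u; exact h2 ⟨u, hA' u⟩
  · intro u i; exact h3 ⟨u, hA' u⟩ i

theorem ball_subset_verts (o r : ℕ) : G.ball o r ⊆ G.verts := fun _ h => h.1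

theorem self_mem_ball {o : ℕ} (ho : o ∈ G.verts) (r : ℕ) : o ∈ G.ball o r := by
  refine ⟨ho, ?_⟩
  simp

theorem ball_zero {o : ℕ} (ho : o ∈ G.verts) : G.ball o 0 = {o} := by
  ext v
  simp only [ball, mem_ofPred_eq, mem_singleton_iff, Nat.cast_zero, nonpos_iff_eq_zero,
    SimpleGraph.edist_eq_zero_iff]
  constructor
  · rintro ⟨_, rfl⟩; rfl
  · rintro rfl; exact ⟨ho, rfl⟩

theorem mem_ball_succ {o r v : ℕ} :
    v ∈ G.ball o (r + 1) ↔ v ∈ G.ball o r ∨ ∃ u ∈ G.ball o r, G.arc u v ∨ G.arc v u := by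
  constructor
  · rintro ⟨hv, hd⟩
    have hne : G.graph.edist v o ≠ ⊤ := by
      rw [SimpleGraph.edist_comm]
      exact ne_top_of_le_ne_top (ENat.natCast_ne_top _) hd
    obtain ⟨p, hp⟩ := SimpleGraph.exists_walk_of_edist_ne_top hne
    rw [SimpleGraph.edist_comm, ← hp] at hd
    cases p with
    | nil => left; exact self_mem_ball hv r
    | @cons _ u _ h q =>
      right
      have huv := (SimpleGraph.fromRel_adj _ _ _).1 h
      refine ⟨u, ⟨?_, ?_⟩, huv.2.symm⟩
      · rcases huv.2 with h | h
        · exact (G.arc_mem _ _ h).2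
        · exact (G.arc_mem _ _ h).1
      · rw [SimpleGraph.edist_comm]
        refine (SimpleGraph.Walk.edist_le q).trans ?_
        rw [SimpleGraph.Walk.length_cons] at hd
        exact_mod_cast Nat.le_of_succ_le_succ (by exact_mod_cast hd)
  · rintro (⟨hv, hd⟩ | ⟨u, ⟨hu, hd⟩, h⟩)
    · exact ⟨hv, hd.trans (by exact_mod_cast Nat.le_succ r)⟩
    · have hv : v ∈ G.verts := by
        rcases h with h | h
        · exact (G.arc_mem _ _ h).2
        · exact (G.arc_mem _ _ h).1
      refine ⟨hv, SimpleGraph.edist_triangle.trans ?_ (b := G.graph.edist o u + G.graph.edist u v)⟩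
      have hne : u ≠ v := by rintro rfl; exact G.arc_irrefl u (by tauto)
      have hadj : G.graph.Adj u v := (SimpleGraph.fromRel_adj _ _ _).2 ⟨hne, h⟩
      rw [SimpleGraph.edist_eq_one_iff_adj.2 hadj]
      push_cast
      gcongr

theorem ball_mono (G : Net X) (o : ℕ) : Monotone (G.ball o) :=
  monotone_nat_of_le_succ fun _ _ hv => mem_ball_succ.2 (Or.inl hv)

theorem ball_subset_ball_add {o u s : ℕ} (hu : u ∈ G.ball o s) (r : ℕ) :
    G.ball u r ⊆ G.ball o (s + r) := by
  induction r with
  | zero => rw [ball_zero hu.1]; simpa using hu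
  | succ r ih =>
    intro v hv
    rcases mem_ball_succ.1 hv with hv | ⟨w, hw, h⟩
    · exact mem_ball_succ.2 (Or.inl (ih hv))
    · exact mem_ball_succ.2 (Or.inr ⟨w, ih hw, h⟩)

theorem ball_eq_of_succ_eq {o r : ℕ} (h : G.ball o (r + 1) = G.ball o r) {s : ℕ} (hs : r ≤ s) :
    G.ball o s = G.ball o r := by
  induction s, hs using Nat.le_induction with
  | base => rfl
  | succ s _ ih =>
    ext v
    rw [mem_ball_succ, ih, ← mem_ball_succ, h]

theorem IsAdmissible.finite_ball {M : ℕ} (hG : G.IsAdmissible M) {o : ℕ} (ho : o ∈ G.verts)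
    (r : ℕ) : (G.ball o r).Finite := by
  induction r with
  | zero => rw [ball_zero ho]; exact finite_singleton o
  | succ r ih =>
    refine (ih.union (ih.biUnion (t := fun u => {w | G.arc u w ∨ G.arc w u})
      fun u hu => ?_)).subset ?_
    · exact Set.finite_of_encard_le_coe (hG.degree_le u hu.1)
    · intro v hv
      rcases mem_ball_succ.1 hv with h | ⟨u, hu, h⟩
      · exact Or.inl h
      · exact Or.inr (mem_iUnion₂.2 ⟨u, hu, h⟩)

theorem IsAdmissible.exists_mem_ball {M : ℕ} (hG : G.IsAdmissible M) {o v : ℕ} (ho : o ∈ G.verts)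
    (hv : v ∈ G.verts) : ∃ r, v ∈ G.ball o r := by
  have := SimpleGraph.edist_ne_top_iff_reachable.2 (hG.connected o ho v hv)
  obtain ⟨n, hn⟩ := ENat.ne_top_iff_exists.1 this
  exact ⟨n, hv, hn.ge⟩

theorem mem_ball_of_equiv {A B : Set ℕ} (f : (G.induce A).verts ≃ (H.induce B).verts)
    (h1 : ∀ u v : (G.induce A).verts, (G.induce A).arc u v ↔ (H.induce B).arc (f u) (f v))
    {o o' : ℕ} (ho : o ∈ G.verts) (ho' : o' ∈ H.verts)
    (hoo : ∀ u : (G.induce A).verts, (u : ℕ) = o ↔ (f u : ℕ) = o') {r : ℕ}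
    (hA : G.ball o r ⊆ A) (u : (G.induce A).verts) (hu : (u : ℕ) ∈ G.ball o r) :
    (f u : ℕ) ∈ H.ball o' r := by
  induction r generalizing u with
  | zero =>
    rw [ball_zero ho] at hu
    rw [ball_zero ho']
    exact (hoo u).1 hu
  | succ r ih =>
    have hA' := (G.ball_mono o (Nat.le_succ r)).trans hA
    rcases mem_ball_succ.1 hu with hu | ⟨w, hw, h⟩
    · exact mem_ball_succ.2 (Or.inl (ih hA' u hu))
    · have hwA : w ∈ (G.induce A).verts := ⟨hw.1, hA' hw⟩
      refine mem_ball_succ.2 (Or.inr ⟨f ⟨w, hwA⟩, ih hA' _ hw, ?_⟩)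
      exact h.imp (fun h => ((h1 ⟨w, hwA⟩ u).1 ⟨hwA.2, u.2.2, h⟩).2.2)
        (fun h => ((h1 u ⟨w, hwA⟩).1 ⟨u.2.2, hwA.2, h⟩).2.2)

/-- Distances are determined by the adjacency relation, so an isomorphism of induced subnetworks
matches balls around corresponding vertices, as long as the subnetworks contain these balls. -/
theorem mem_ball_iff_of_equiv {A B : Set ℕ} (f : (G.induce A).verts ≃ (H.induce B).verts)
    (h1 : ∀ u v : (G.induce A).verts, (G.induce A).arc u v ↔ (H.induce B).arc (f u) (f v))
    {o o' : ℕ} (ho : o ∈ G.verts) (ho' : o' ∈ H.verts)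
    (hoo : ∀ u : (G.induce A).verts, (u : ℕ) = o ↔ (f u : ℕ) = o') {r : ℕ}
    (hA : G.ball o r ⊆ A) (hB : H.ball o' r ⊆ B) (u : (G.induce A).verts) :
    (u : ℕ) ∈ G.ball o r ↔ (f u : ℕ) ∈ H.ball o' r := by
  refine ⟨mem_ball_of_equiv f h1 ho ho' hoo hA u, fun h => ?_⟩
  have := mem_ball_of_equiv f.symm (fun u v => by simpa using (h1 (f.symm u) (f.symm v)).symm)
    ho' ho (fun u => by simpa using (hoo (f.symm u)).symm) hB (f u) h
  simpa using this

theorem Iso.restrict_ball {A B : Set ℕ} {p q : ι → ℕ} (h : (G.induce A).Iso (H.induce B) p q)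
    (i : ι) (hp : p i ∈ G.verts) (hq : q i ∈ H.verts) {r : ℕ}
    (hA : G.ball (p i) r ⊆ A) (hB : H.ball (q i) r ⊆ B) :
    (G.induce (G.ball (p i) r)).Iso (H.induce (H.ball (q i) r)) p q := by
  obtain ⟨f, h1, h2, h3⟩ := h
  exact iso_induce_of_mem_iff f h1 h2 h3 hA hB
    (mem_ball_iff_of_equiv f h1 hp hq (fun u => h3 u i) hA hB)

theorem induce_ball_verts (G : Net X) (o r : ℕ) : (G.induce (G.ball o r)).verts = G.ball o r :=
  inter_eq_self_of_subset_right (ball_subset_verts o r)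

theorem Iso.ncard_verts_eq {p q : ι → ℕ} (h : G.Iso H p q) : G.verts.ncard = H.verts.ncard := by
  obtain ⟨f, -⟩ := h
  exact Nat.card_congr f

end Net

/-! ### Events that depend on a ball are measurable -/

namespace Net

variable {X : Type*} {M : ℕ}

/-- The network with the marks outside the vertex set replaced by the constant `x`. -/
def normalize (G : Net X) (x : X) [DecidablePred (· ∈ G.verts)] : Net X :=
  { G with mark := fun v => if v ∈ G.verts then G.mark v else x }

theorem iso_normalize (G : Net X) (x : X) [DecidablePred (· ∈ G.verts)] {ι : Type} (p : ι → ℕ) :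
    G.Iso (G.normalize x) p p :=
  ⟨Equiv.refl _, fun _ _ => Iff.rfl, fun u => (if_pos u.2).symm, fun _ _ => Iff.rfl⟩

/-- The finite networks whose marks outside the vertex set equal `x`. They represent all finite
networks up to isomorphism. -/
def finiteNets (x : X) : Set (Net X) := {g | g.verts.Finite ∧ ∀ v, v ∉ g.verts → g.mark v = x}

theorem countable_finiteNets [Countable X] (x : X) : (finiteNets x).Countable := by
  have key : ∀ g : finiteNets x, {a : ℕ × ℕ | g.1.arc a.1 a.2}.Finite := fun g =>
    (g.2.1.prod g.2.1).subset fun a ha => g.1.arc_mem _ _ ha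
  have key' : ∀ g : finiteNets x, ((fun v => (v, g.1.mark v)) '' g.1.verts).Finite := fun g =>
    g.2.1.image _
  let F : finiteNets x → Finset ℕ × Finset (ℕ × ℕ) × Finset (ℕ × X) := fun g =>
    (g.2.1.toFinset, (key g).toFinset, (key' g).toFinset)
  have hF : Function.Injective F := by
    rintro g h hgh
    obtain ⟨e1, e2, e3⟩ : g.1.verts = h.1.verts ∧
        {a : ℕ × ℕ | g.1.arc a.1 a.2} = {a : ℕ × ℕ | h.1.arc a.1 a.2} ∧
        (fun v => (v, g.1.mark v)) '' g.1.verts = (fun v => (v, h.1.mark v)) '' h.1.verts := by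
      simpa [F, Prod.ext_iff] using hgh
    have e2' : g.1.arc = h.1.arc := by
      funext u v
      exact propext (Set.ext_iff.1 e2 (u, v))
    have e3' : g.1.mark = h.1.mark := by
      funext v
      by_cases hv : v ∈ g.1.verts
      · have : (v, g.1.mark v) ∈ (fun v => (v, h.1.mark v)) '' h.1.verts :=
          e3 ▸ mem_image_of_mem _ hv
        obtain ⟨w, _, hw⟩ := this
        obtain ⟨rfl, h'⟩ := Prod.ext_iff.1 hw
        exact h'.symm
      · rw [g.2.2 v hv, h.2.2 v (e1 ▸ hv)]
    obtain ⟨⟨_, _, _, _, _⟩, _⟩ := g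
    obtain ⟨⟨_, _, _, _, _⟩, _⟩ := h
    simp only at e1 e2' e3'
    subst e1 e2' e3'
    rfl
  exact hF.countable

open scoped Classical in
theorem exists_finiteNets_iso (x : X) {G : Net X} (hG : G.verts.Finite) {ι : Type} (p : ι → ℕ) :
    ∃ g ∈ finiteNets x, g.verts = G.verts ∧ G.Iso g p p :=
  ⟨G.normalize x, ⟨hG, fun _ hv => if_neg hv⟩, rfl, G.iso_normalize x p⟩

section Measurability

variable {Y : Type*} [MeasurableSpace Y] {N : Y → Net X} {o : Y → ℕ}

/-- The sizes of the balls around the root form an increasing sequence that is constant from the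
first repetition on. So the set of all sizes of balls, whatever their radii, determines the size of
each ball. -/
theorem measurableSet_ncard_ball (hN : ∀ y, (N y).IsAdmissible M) (ho : ∀ y, o y ∈ (N y).verts)
    (hD : ∀ d, MeasurableSet {y | ∃ r, ((N y).ball (o y) r).ncard = d}) (r d : ℕ) :
    MeasurableSet {y | ((N y).ball (o y) r).ncard = d} := by
  induction r generalizing d with
  | zero =>
    have : {y | ((N y).ball (o y) 0).ncard = d} = {_y | d = 1} := by
      ext y
      simp [ball_zero (ho y), eq_comm]
    rw [this]
    exact MeasurableSet.const _
  | succ r ih =>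
    have : {y | ((N y).ball (o y) (r + 1)).ncard = d} =
        (⋃ c ∈ Set.Iio d, {y | ((N y).ball (o y) r).ncard = c} ∩
          {y | ∃ s, ((N y).ball (o y) s).ncard = d} ∩
          ⋂ e ∈ Set.Ioo c d, {y | ∃ s, ((N y).ball (o y) s).ncard = e}ᶜ) ∪
        ({y | ((N y).ball (o y) r).ncard = d} ∩
          ⋂ e ∈ Set.Ioi d, {y | ∃ s, ((N y).ball (o y) s).ncard = e}ᶜ) := by
      ext y
      have hfin : ∀ s, ((N y).ball (o y) s).Finite := (hN y).finite_ball (ho y)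
      have hmono : ∀ s t, s ≤ t → ((N y).ball (o y) s).ncard ≤ ((N y).ball (o y) t).ncard :=
        fun s t h => ncard_le_ncard ((N y).ball_mono _ h) (hfin t)
      have hstab : ((N y).ball (o y) (r + 1)).ncard = ((N y).ball (o y) r).ncard → ∀ s, r ≤ s →
          ((N y).ball (o y) s).ncard = ((N y).ball (o y) r).ncard := fun h s hs => by
        rw [ball_eq_of_succ_eq (eq_of_subset_of_ncard_le ((N y).ball_mono _ (Nat.le_succ r))
          h.le (hfin _)).symm hs]
      have hle := hmono r (r + 1) (Nat.le_succ r)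
      simp only [mem_ofPred_eq, mem_union, mem_iUnion, mem_inter_iff, mem_iInter, mem_compl_iff,
        exists_prop, not_exists, mem_Iio, mem_Ioo, mem_Ioi]
      constructor
      · intro h
        rcases hle.eq_or_lt with heq | hlt
        · right
          refine ⟨heq.trans h, fun e he s hs => ?_⟩
          rcases le_total r s with hrs | hrs
          · have := hstab heq.symm s hrs
            omega
          · have := hmono s r hrs
            omega
        · left
          refine ⟨_, h ▸ hlt, ⟨rfl, r + 1, h⟩, fun e he s hs => ?_⟩
          rcases Nat.lt_or_ge r s with hrs | hrs
          · have := hmono (r + 1) s hrs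
            omega
          · have := hmono s r hrs
            omega
      · rintro (⟨c, hc, ⟨rfl, s, hs⟩, he⟩ | ⟨h, he⟩)
        · by_contra hne
          rcases lt_or_gt_of_ne hne with hlt | hgt
          · rcases hle.eq_or_lt with heq | hlt'
            · rcases le_total r s with hrs | hrs
              · have := hstab heq.symm s hrs
                omega
              · have := hmono s r hrs
                omega
            · exact he _ ⟨hlt', hlt⟩ (r + 1) rfl
          · rcases Nat.lt_or_ge r s with hrs | hrs
            · have := hmono (r + 1) s hrs
              omega
            · have := hmono s r hrs
              omega
        · rcases hle.eq_or_lt with heq | hlt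
          · omega
          · exact absurd rfl (he _ (h ▸ hlt) (r + 1))
    rw [this]
    refine MeasurableSet.union ?_ ?_
    · exact MeasurableSet.biUnion (Set.to_countable _) fun c _ =>
        ((ih c).inter (hD d)).inter
          (MeasurableSet.biInter (Set.to_countable _) fun e _ => (hD e).compl)
    · exact (ih d).inter (MeasurableSet.biInter (Set.to_countable _) fun e _ => (hD e).compl)

theorem measurableSet_exists_ncard_ball [Countable X] [Nonempty X]
    (hN : ∀ y, (N y).IsAdmissible M) (ho : ∀ y, o y ∈ (N y).verts)
    (hE : ∀ (g : Net X) (w : ℕ), g.verts.Finite → w ∈ g.verts → MeasurableSet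
      {y | ∃ r, ((N y).induce ((N y).ball (o y) r)).Iso g (fun _ : Unit => o y) (fun _ => w)})
    (d : ℕ) : MeasurableSet {y | ∃ r, ((N y).ball (o y) r).ncard = d} := by
  obtain ⟨x⟩ := ‹Nonempty X›
  have : {y | ∃ r, ((N y).ball (o y) r).ncard = d} =
      ⋃ a ∈ (finiteNets x ×ˢ (univ : Set ℕ)) ∩ {a | a.2 ∈ a.1.verts ∧ a.1.verts.ncard = d},
        {y | ∃ r, ((N y).induce ((N y).ball (o y) r)).Iso a.1
          (fun _ : Unit => o y) (fun _ => a.2)} := by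
    ext y
    simp only [mem_ofPred_eq, mem_iUnion, mem_inter_iff, mem_prod, mem_univ, and_true,
      exists_prop, Prod.exists]
    constructor
    · rintro ⟨r, hr⟩
      have hfin := (hN y).finite_ball (ho y) r
      rw [← induce_ball_verts] at hfin
      obtain ⟨g, hg, hgv, hiso⟩ := exists_finiteNets_iso x hfin (fun _ : Unit => o y)
      rw [induce_ball_verts] at hgv
      exact ⟨g, o y, ⟨hg, hgv ▸ self_mem_ball (ho y) r, hgv ▸ hr⟩, r, hiso⟩
    · rintro ⟨g, w, ⟨_, _, hd⟩, r, hiso⟩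
      refine ⟨r, ?_⟩
      rw [← hd, ← hiso.ncard_verts_eq, induce_ball_verts]
  rw [this]
  refine MeasurableSet.biUnion ?_ fun a ha => hE _ _ ha.1.1.1 ha.2.1
  exact ((countable_finiteNets x).prod countable_univ).mono inter_subset_left

/-- A cylinder says that a ball of unspecified radius looks like `g`. Balls around the root are
nested, so the size of the ball of radius `r` tells whether it is this one. -/
theorem measurableSet_iso_ball {ι : Type} [Countable X] [Nonempty X]
    {p : Y → ι → ℕ} (hN : ∀ y, (N y).IsAdmissible M) (ho : ∀ y, o y ∈ (N y).verts)
    (hE : ∀ (g : Net X) (w : ℕ), g.verts.Finite → w ∈ g.verts → MeasurableSet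
      {y | ∃ r, ((N y).induce ((N y).ball (o y) r)).Iso g (fun _ : Unit => o y) (fun _ => w)})
    (hE' : ∀ (g : Net X) (w : ι → ℕ), g.verts.Finite → (∀ i, w i ∈ g.verts) → MeasurableSet
      {y | ∃ r, ((N y).induce ((N y).ball (o y) r)).Iso g (p y) w})
    (r : ℕ) {g : Net X} {w : ι → ℕ} (hg : g.verts.Finite) (hw : ∀ i, w i ∈ g.verts) :
    MeasurableSet {y | ((N y).induce ((N y).ball (o y) r)).Iso g (p y) w} := by
  have : {y | ((N y).induce ((N y).ball (o y) r)).Iso g (p y) w} =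
      {y | ∃ r, ((N y).induce ((N y).ball (o y) r)).Iso g (p y) w} ∩
      {y | ((N y).ball (o y) r).ncard = g.verts.ncard} := by
    ext y
    constructor
    · intro h
      refine ⟨⟨r, h⟩, ?_⟩
      have := h.ncard_verts_eq
      rwa [induce_ball_verts] at this
    · rintro ⟨⟨s, hs⟩, hr⟩
      have hc := hs.ncard_verts_eq
      rw [induce_ball_verts] at hc
      have hfin := (hN y).finite_ball (ho y)
      have : (N y).ball (o y) s = (N y).ball (o y) r := by
        rcases le_total s r with h | h
        · exact eq_of_subset_of_ncard_le ((N y).ball_mono _ h) (by rw [hc, hr]) (hfin _)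
        · exact (eq_of_subset_of_ncard_le ((N y).ball_mono _ h) (by rw [hc, hr]) (hfin _)).symm
      change ((N y).induce ((N y).ball (o y) r)).Iso g (p y) w
      rwa [← this]
  rw [this]
  exact (hE' g w hg hw).inter
    (measurableSet_ncard_ball hN ho (measurableSet_exists_ncard_ball hN ho hE) r _)

/-- A property that depends only on the isomorphism class of the ball of radius `r`, with finitely
many distinguished vertices in it, is measurable: there are only countably many isomorphism classes
of finite networks. -/
theorem measurableSet_of_ball {ι : Type} [Countable X] [Nonempty X] [Finite ι]
    {p : Y → ι → ℕ} (hN : ∀ y, (N y).IsAdmissible M) (ho : ∀ y, o y ∈ (N y).verts)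
    (hE : ∀ (g : Net X) (w : ℕ), g.verts.Finite → w ∈ g.verts → MeasurableSet
      {y | ∃ r, ((N y).induce ((N y).ball (o y) r)).Iso g (fun _ : Unit => o y) (fun _ => w)})
    (hE' : ∀ (g : Net X) (w : ι → ℕ), g.verts.Finite → (∀ i, w i ∈ g.verts) → MeasurableSet
      {y | ∃ r, ((N y).induce ((N y).ball (o y) r)).Iso g (p y) w})
    (r : ℕ) (hp : ∀ y i, p y i ∈ (N y).ball (o y) r) {P : Y → Prop}
    (hP : ∀ y y', ((N y).induce ((N y).ball (o y) r)).Iso ((N y').induce ((N y').ball (o y') r))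
      (p y) (p y') → P y → P y') :
    MeasurableSet {y | P y} := by
  obtain ⟨x⟩ := ‹Nonempty X›
  have : {y | P y} = ⋃ a ∈ (finiteNets x ×ˢ (univ : Set (ι → ℕ))) ∩ {a | (∀ i, a.2 i ∈ a.1.verts) ∧
      ∃ y, P y ∧ ((N y).induce ((N y).ball (o y) r)).Iso a.1 (p y) a.2},
      {y | ((N y).induce ((N y).ball (o y) r)).Iso a.1 (p y) a.2} := by
    ext y
    simp only [mem_ofPred_eq, mem_iUnion, mem_inter_iff, mem_prod, mem_univ, and_true,
      exists_prop, Prod.exists]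
    constructor
    · intro h
      have hfin := (hN y).finite_ball (ho y) r
      rw [← induce_ball_verts] at hfin
      obtain ⟨g, hg, hgv, hiso⟩ := exists_finiteNets_iso x hfin (p y)
      rw [induce_ball_verts] at hgv
      exact ⟨g, p y, ⟨hg, fun i => hgv ▸ hp y i, y, h, hiso⟩, hiso⟩
    · rintro ⟨g, w, ⟨_, _, y', hy', h'⟩, h⟩
      exact hP y' y (h'.trans h.symm) hy'
  rw [this]
  refine MeasurableSet.biUnion ?_ fun a ha => measurableSet_iso_ball hN ho hE hE' r ha.1.1.1 ha.2.1
  exact ((countable_finiteNets x).prod countable_univ).mono inter_subset_left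

end Measurability

end Net

namespace RootedNetwork

variable {X : Type*} {M : ℕ}

theorem measurableSet_cylinder {g : Net X} {o : ℕ} (hg : g.verts.Finite) (ho : o ∈ g.verts) :
    MeasurableSet (cylinder X M g o) :=
  MeasurableSpace.measurableSet_generateFrom ⟨g, o, hg, ho, rfl⟩

theorem measurableSet_of_ball [Countable X] [Nonempty X] (r : ℕ) {P : RootedNetwork X M → Prop}
    (hP : ∀ x y : RootedNetwork X M, (x.toNet.induce (x.toNet.ball x.root r)).Iso
      (y.toNet.induce (y.toNet.ball y.root r)) (fun _ : Unit => x.root) (fun _ => y.root) →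
      P x → P y) : MeasurableSet {x | P x} := by
  refine Net.measurableSet_of_ball (N := fun x : RootedNetwork X M => x.toNet)
    (fun x => x.admissible) (fun x => x.root_mem) (fun g w hg hw => measurableSet_cylinder hg hw)
    (fun g w hg hw => measurableSet_cylinder hg (hw ())) r
    (fun x _ => Net.self_mem_ball x.root_mem r) hP

end RootedNetwork

namespace WalkNetwork

variable {X : Type*} {M : ℕ}

theorem measurableSet_cylinder {g : Net X} {n : ℕ} {w : Fin (n + 1) → ℕ} (hg : g.verts.Finite)
    (hw : ∀ i, w i ∈ g.verts) : MeasurableSet (cylinder X M g w) :=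
  MeasurableSpace.measurableSet_generateFrom ⟨g, n, w, hg, hw, rfl⟩

theorem walk_mem_ball (x : WalkNetwork X M) (i : ℕ) :
    x.walk i ∈ x.toNet.ball (x.walk 0) i := by
  induction i with
  | zero => exact Net.self_mem_ball (x.walk_mem.1 0) 0
  | succ i ih =>
    rcases x.walk_mem.2 i with h | ⟨_, h⟩
    · exact Net.mem_ball_succ.2 (Or.inr ⟨_, ih, Or.inl h⟩)
    · rw [h]
      exact Net.mem_ball_succ.2 (Or.inl ih)

theorem measurableSet_of_ball [Countable X] [Nonempty X] {n r : ℕ} (hnr : n ≤ r)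
    {P : WalkNetwork X M → Prop}
    (hP : ∀ x y : WalkNetwork X M, (x.toNet.induce (x.toNet.ball (x.walk 0) r)).Iso
      (y.toNet.induce (y.toNet.ball (y.walk 0) r)) (fun i : Fin (n + 1) => x.walk i)
      (fun i : Fin (n + 1) => y.walk i) → P x → P y) : MeasurableSet {x | P x} := by
  refine Net.measurableSet_of_ball (N := fun x : WalkNetwork X M => x.toNet)
    (fun x => x.admissible) (fun x => x.walk_mem.1 0) (fun g w hg hw => ?_)
    (fun g w hg hw => measurableSet_cylinder hg hw) r
    (fun x i => x.toNet.ball_mono _ ((Nat.le_of_lt_succ i.2).trans hnr) (x.walk_mem_ball i)) hP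
  convert! measurableSet_cylinder (X := X) (M := M) (n := 0) (w := fun _ => w) hg (fun _ => hw)
    using 1
  ext x
  refine exists_congr fun r => ⟨fun h => ?_, fun h => h.comp (fun _ : Unit => (0 : Fin 1))⟩
  convert! h.comp (fun _ : Fin 1 => ()) using 1
  funext i
  obtain rfl : i = (0 : Fin 1) := Subsingleton.elim (α := Fin 1) _ _
  rfl

theorem measurable_shift [Countable X] [Nonempty X] :
    Measurable (shift : WalkNetwork X M → WalkNetwork X M) := by
  refine measurable_generateFrom ?_
  rintro _ ⟨g, n, w, hg, hw, rfl⟩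
  have : shift ⁻¹' (cylinder X M g w) = ⋃ r : ℕ, {x | (x.toNet.induce (x.toNet.ball (x.walk 1) r)).Iso
      g (fun i : Fin (n + 1) => x.walk (i + 1)) w} := by
    ext x
    simp only [mem_iUnion]
    rfl
  rw [this]
  refine MeasurableSet.iUnion fun r => ?_
  refine measurableSet_of_ball (n := n + 1) (r := max (1 + r) (n + 1)) (le_max_right _ _) ?_
  intro x y hxy hx
  have hsub : ∀ z : WalkNetwork X M,
      z.toNet.ball (z.walk 1) r ⊆ z.toNet.ball (z.walk 0) (max (1 + r) (n + 1)) := fun z =>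
    (Net.ball_subset_ball_add (z.walk_mem_ball 1) r).trans (z.toNet.ball_mono _ (le_max_left _ _))
  have := (hxy.restrict_ball (1 : Fin (n + 1 + 1)) (x.walk_mem.1 _) (y.walk_mem.1 _)
    (r := r) (by simpa using hsub x) (by simpa using hsub y)).comp
      (fun i : Fin (n + 1) => i.succ)
  refine Net.Iso.trans ?_ hx
  exact this.symm

/-- Measurable sets do not distinguish isomorphic networks with walks. -/
theorem mem_iff_of_iso {x y : WalkNetwork X M}
    (h : x.toNet.Iso y.toNet x.walk y.walk) {A : Set (WalkNetwork X M)} (hA : MeasurableSet A) :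
    x ∈ A ↔ y ∈ A := by
  induction A, hA using MeasurableSpace.generateFrom_induction with
  | hC A hA =>
    obtain ⟨g, n, w, hg, hw, rfl⟩ := hA
    obtain ⟨f, h1, h2, h3⟩ := h
    have hb : ∀ r, (x.toNet.induce (x.toNet.ball (x.walk 0) r)).Iso
        (y.toNet.induce (y.toNet.ball (y.walk 0) r)) (fun i : Fin (n + 1) => x.walk i)
        (fun i : Fin (n + 1) => y.walk i) := by
      intro r
      have h' : (x.toNet.induce univ).Iso (y.toNet.induce univ) (fun i : Fin (n + 1) => x.walk i)
          (fun i : Fin (n + 1) => y.walk i) :=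
        ⟨((Equiv.setCongr (inter_univ _)).trans f).trans (Equiv.setCongr (inter_univ _).symm),
          fun u v => by
            have := h1 ⟨u, u.2.1⟩ ⟨v, v.2.1⟩
            exact ⟨fun h => ⟨trivial, trivial, this.1 h.2.2⟩, fun h => ⟨trivial, trivial,
              this.2 h.2.2⟩⟩,
          fun u => h2 ⟨u, u.2.1⟩, fun u i => h3 ⟨u, u.2.1⟩ i⟩
      exact h'.restrict_ball (0 : Fin (n + 1)) (x.walk_mem.1 _) (y.walk_mem.1 _)
        (subset_univ _) (subset_univ _)
    exact exists_congr fun r => ⟨fun h => (hb r).symm.trans h, fun h => (hb r).trans h⟩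
  | empty => simp
  | compl t _ ht => exact not_congr ht
  | iUnion s _ hs => simp only [mem_iUnion]; exact exists_congr hs

end WalkNetwork

/-! ### Measures on sequences -/

/-- The sequences whose first `n` terms agree with those of `t`. -/
def initialCylinder {E : Type*} (t : ℕ → E) (n : ℕ) : Set (ℕ → E) := {s | ∀ i < n, s i = t i}

section Sequences

variable {E : Type*} [MeasurableSpace E] [MeasurableSingletonClass E]

theorem measurableSet_initialCylinder (t : ℕ → E) (n : ℕ) :
    MeasurableSet (initialCylinder t n) := by
  have : initialCylinder t n = ⋂ i ∈ Set.Iio n, (fun s : ℕ → E => s i) ⁻¹' {t i} := by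
    ext s
    simp [initialCylinder]
  rw [this]
  exact MeasurableSet.biInter (Set.to_countable _) fun i _ =>
    measurable_pi_apply i (measurableSet_singleton _)

/-- Finite measures on the sequences in a countable set that agree on all initial cylinders are
equal. -/
theorem MeasureTheory.Measure.ext_of_initialCylinder [Countable E] {μ ν : Measure (ℕ → E)}
    [IsFiniteMeasure μ] (h : ∀ t n, μ (initialCylinder t n) = ν (initialCylinder t n)) : μ = ν := by
  rcases isEmpty_or_nonempty (ℕ → E) with hE | ⟨⟨t₀⟩⟩
  · ext s
    rw [Set.eq_empty_of_isEmpty s, measure_empty, measure_empty]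
  refine ext_of_generate_finite {A | ∃ t n, A = initialCylinder t n} ?_ ?_ ?_ ?_
  · refine le_antisymm (iSup_le fun i => ?_) ?_
    · rw [← measurable_iff_comap_le]
      refine @measurable_to_countable' E (ℕ → E) _ _ (MeasurableSpace.generateFrom _) _ fun a => ?_
      have : (fun s : ℕ → E => s i) ⁻¹' {a} = ⋃ t : Fin i → E,
          initialCylinder (fun j => if h : j < i then t ⟨j, h⟩ else a) (i + 1) := by
        ext s
        simp only [mem_preimage, mem_singleton_iff, mem_iUnion, initialCylinder, mem_ofPred_eq]
        constructor
        · rintro rfl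
          refine ⟨fun j => s j, fun j hj => ?_⟩
          split_ifs with hji
          · rfl
          · rw [show j = i by omega]
        · rintro ⟨t, ht⟩
          simpa using ht i (Nat.lt_succ_self i)
      rw [this]
      exact MeasurableSet.iUnion fun t => MeasurableSpace.measurableSet_generateFrom ⟨_, _, rfl⟩
    · refine MeasurableSpace.generateFrom_le ?_
      rintro _ ⟨t, n, rfl⟩
      exact measurableSet_initialCylinder t n
  · rintro _ ⟨t, n, rfl⟩ _ ⟨t', n', rfl⟩ ⟨s, hs, hs'⟩
    refine ⟨s, max n n', ?_⟩
    ext s'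
    constructor
    · rintro ⟨h1, h2⟩ i hi
      rcases lt_max_iff.1 hi with hi | hi
      · rw [h1 i hi, hs i hi]
      · rw [h2 i hi, hs' i hi]
    · intro h1
      exact ⟨fun i hi => by rw [h1 i (lt_max_of_lt_left hi), hs i hi],
        fun i hi => by rw [h1 i (lt_max_of_lt_right hi), hs' i hi]⟩
  · rintro _ ⟨t, n, rfl⟩
    exact h t n
  · simpa [initialCylinder] using h t₀ 0

end Sequences

/-! ### The simple random walk -/

namespace Net

variable {X : Type*} {M : ℕ} {G H : Net X}

instance (G : Net X) (o : ℕ) : IsProbabilityMeasure (G.srw o) := by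
  unfold srw; infer_instance

theorem srw_initialCylinder (G : Net X) (o : ℕ) (t : ℕ → ℕ) (n : ℕ) :
    G.srw o (initialCylinder t (n + 1)) =
      (if t 0 = o then 1 else 0) * ∏ i ∈ Finset.range n, G.stepPMF (t i) (t (i + 1)) := by
  have hpre : ∀ n, initialCylinder t (n + 1) =
      Preorder.frestrictLe (π := fun _ => ℕ) n ⁻¹' {Preorder.frestrictLe (π := fun _ => ℕ) n t} := by
    intro n
    ext s
    simp only [initialCylinder, mem_ofPred_eq, mem_preimage, mem_singleton_iff, funext_iff,
      Subtype.forall, Finset.mem_Iic, Preorder.frestrictLe_apply, Nat.lt_succ_iff]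
  have hmap : ∀ n, G.srw o (initialCylinder t (n + 1)) =
      Kernel.partialTraj (X := fun _ => ℕ) G.stepKernel 0 n (fun _ => o)
        {Preorder.frestrictLe (π := fun _ => ℕ) n t} := by
    intro n
    rw [hpre, ← Kernel.traj_map_frestrictLe_apply,
      Measure.map_apply (by fun_prop) (measurableSet_singleton _)]
    rfl
  induction n with
  | zero =>
    rw [hmap, Kernel.partialTraj_self, Kernel.id_apply,
      Measure.dirac_apply' _ (measurableSet_singleton _)]
    simp only [Finset.range_zero, Finset.prod_empty, mul_one]
    split_ifs with h
    · refine indicator_of_mem ?_ _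
      rw [mem_singleton_iff]
      funext i
      obtain ⟨i, hi⟩ := i
      have : i = 0 := by simpa using hi
      subst this
      exact h.symm
    · refine indicator_of_notMem (fun h' => h ?_) _
      exact (congrFun (mem_singleton_iff.1 h') ⟨0, by simp⟩).symm
  | succ n ih =>
    have hset : initialCylinder t (n + 1 + 1) =
        (fun x => (Preorder.frestrictLe (π := fun _ => ℕ) n x, x (n + 1))) ⁻¹'
        ({Preorder.frestrictLe (π := fun _ => ℕ) n t} ×ˢ {t (n + 1)}) := by
      ext s
      have : Preorder.frestrictLe (π := fun _ => ℕ) n s ∈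
          ({Preorder.frestrictLe (π := fun _ => ℕ) n t} : Set _) ↔
          s ∈ initialCylinder t (n + 1) := by rw [hpre n, mem_preimage]
      rw [mem_preimage, mem_prod, this]
      simp only [initialCylinder, mem_ofPred_eq, mem_singleton_iff]
      exact ⟨fun h => ⟨fun i hi => h i (by omega), h _ (by omega)⟩, fun h i hi => by
        rcases Nat.lt_succ_iff_lt_or_eq.1 hi with hi | rfl
        · exact h.1 i hi
        · exact h.2⟩
    rw [Finset.prod_range_succ, ← mul_assoc, ← ih, hmap n, hset, srw,
      ← Measure.map_apply (by fun_prop)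
        ((measurableSet_singleton _).prod (measurableSet_singleton _)),
      ← Kernel.partialTraj_compProd_eq_map_traj (Nat.zero_le n),
      Measure.compProd_apply_prod (measurableSet_singleton _) (measurableSet_singleton _),
      lintegral_singleton, mul_comm]
    congr 1
    change (G.stepPMF (t n)).toMeasure {t (n + 1)} = _
    rw [PMF.toMeasure_apply_singleton _ _ (measurableSet_singleton _)]

open scoped Classical in
theorem stepPMF_apply {v : ℕ} (hv : {w | G.arc v w}.Finite) (w : ℕ) :
    G.stepPMF v w = if {w | G.arc v w}.Nonempty then
      (if G.arc v w then ((Nat.card {w | G.arc v w} : ℕ) : ENNReal)⁻¹ else 0)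
      else if w = v then 1 else 0 := by
  unfold stepPMF
  by_cases h : {w | G.arc v w}.Nonempty
  · rw [dif_pos ⟨hv, h⟩, if_pos h, PMF.uniformOfFinset_apply, Nat.card_coe_set_eq,
      Set.ncard_eq_toFinset_card _ hv]
    simp
  · rw [dif_neg (fun h' => h h'.2), if_neg h, PMF.pure_apply]
    congr!

theorem IsAdmissible.finite_arc (hG : G.IsAdmissible M) {v : ℕ} (hv : v ∈ G.verts) :
    {w | G.arc v w}.Finite :=
  (Set.finite_of_encard_le_coe (hG.degree_le v hv)).subset fun _ h => Or.inl h

/-- An isomorphism of induced subnetworks matches the out-neighbours of corresponding vertices, as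
long as the subnetworks contain them. -/
theorem nonempty_arc_equiv {A B : Set ℕ} (f : (G.induce A).verts ≃ (H.induce B).verts)
    (h1 : ∀ u v : (G.induce A).verts, (G.induce A).arc u v ↔ (H.induce B).arc (f u) (f v))
    (u : (G.induce A).verts) (hA : ∀ w, G.arc u w → w ∈ A) (hB : ∀ w, H.arc (f u) w → w ∈ B) :
    Nonempty ({w | G.arc u w} ≃ {w | H.arc (f u) w}) := by
  have h1' : ∀ a b : (G.induce A).verts, G.arc a b ↔ H.arc (f a) (f b) := fun a b =>
    ⟨fun h => ((h1 a b).1 ⟨a.2.2, b.2.2, h⟩).2.2,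
      fun h => ((h1 a b).2 ⟨(f a).2.2, (f b).2.2, h⟩).2.2⟩
  exact ⟨
    { toFun := fun w => ⟨f ⟨w, (G.arc_mem _ _ w.2).2, hA w w.2⟩, (h1' _ _).1 w.2⟩
      invFun := fun w => ⟨f.symm ⟨w, (H.arc_mem _ _ w.2).2, hB w w.2⟩, by
        refine (h1' _ _).2 ?_
        rw [Equiv.apply_symm_apply]
        exact w.2⟩
      left_inv := fun w => Subtype.ext (congrArg (fun a : (G.induce A).verts => (a : ℕ))
        (f.symm_apply_apply ⟨w, (G.arc_mem _ _ w.2).2, hA w w.2⟩))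
      right_inv := fun w => Subtype.ext (congrArg (fun a : (H.induce B).verts => (a : ℕ))
        (f.apply_symm_apply ⟨w, (H.arc_mem _ _ w.2).2, hB w w.2⟩)) }⟩

open scoped Classical in
theorem stepPMF_eq_of_equiv {A B : Set ℕ} (f : (G.induce A).verts ≃ (H.induce B).verts)
    (h1 : ∀ u v : (G.induce A).verts, (G.induce A).arc u v ↔ (H.induce B).arc (f u) (f v))
    (u v : (G.induce A).verts) (hu : {w | G.arc u w}.Finite) (hu' : {w | H.arc (f u) w}.Finite)
    (hA : ∀ w, G.arc u w → w ∈ A) (hB : ∀ w, H.arc (f u) w → w ∈ B) :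
    G.stepPMF u v = H.stepPMF (f u) (f v) := by
  have huv : G.arc u v ↔ H.arc (f u) (f v) :=
    ⟨fun h => ((h1 u v).1 ⟨u.2.2, v.2.2, h⟩).2.2,
      fun h => ((h1 u v).2 ⟨(f u).2.2, (f v).2.2, h⟩).2.2⟩
  obtain ⟨e⟩ := nonempty_arc_equiv f h1 u hA hB
  rw [stepPMF_apply hu, stepPMF_apply hu']
  have hne : {w | G.arc u w}.Nonempty ↔ {w | H.arc (f u) w}.Nonempty := by
    rw [← Set.nonempty_coe_sort, ← Set.nonempty_coe_sort]
    exact e.nonempty_congr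
  have hvu : ((v : ℕ) = u) ↔ ((f v : ℕ) = f u) := by
    rw [Subtype.coe_inj, Subtype.coe_inj, f.injective.eq_iff]
  rw [Nat.card_congr e]
  exact if_congr hne (if_congr huv rfl rfl) (if_congr hvu rfl rfl)

theorem ae_srw_zero (G : Net X) (o : ℕ) : ∀ᵐ s ∂(G.srw o), s 0 = o := by
  have h := G.srw_initialCylinder o (fun _ => o) 0
  simp only [initialCylinder, zero_add, Nat.lt_one_iff, forall_eq, if_true, Finset.range_zero,
    Finset.prod_empty, mul_one] at h
  have hm : MeasurableSet {s : ℕ → ℕ | s 0 = o} :=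
    (measurable_pi_apply 0 : Measurable fun s : ℕ → ℕ => s 0) (measurableSet_singleton o)
  exact (prob_compl_eq_zero_iff hm).2 h

theorem ae_srw_step (G : Net X) (o i : ℕ) :
    ∀ᵐ s ∂(G.srw o), G.stepPMF (s i) (s (i + 1)) ≠ 0 := by
  have : {s : ℕ → ℕ | ¬ G.stepPMF (s i) (s (i + 1)) ≠ 0} ⊆
      ⋃ t ∈ {t : Fin (i + 2) → ℕ | G.stepPMF (t ⟨i, by omega⟩) (t ⟨i + 1, by omega⟩) = 0},
        initialCylinder (fun j => if h : j < i + 2 then t ⟨j, h⟩ else 0) (i + 2) := by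
    intro s hs
    refine mem_iUnion₂.2 ⟨fun j => s j, not_not.1 hs, fun j hj => ?_⟩
    simp [hj]
  refine measure_mono_null this ((measure_biUnion_null_iff (Set.to_countable _)).2 fun t ht => ?_)
  rw [srw_initialCylinder, Finset.prod_range_succ]
  have ht' : G.stepPMF (t ⟨i, by omega⟩) (t ⟨i + 1, by omega⟩) = 0 := ht
  simp [ht']

theorem measurableSet_walks (G : Net X) : MeasurableSet G.walks := by
  have : G.walks = (⋂ i, (fun s : ℕ → ℕ => s i) ⁻¹' G.verts) ∩
      ⋂ i, (fun s : ℕ → ℕ => (s i, s (i + 1))) ⁻¹'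
        {a | G.arc a.1 a.2 ∨ ((∀ w, ¬ G.arc a.1 w) ∧ a.2 = a.1)} := by
    ext s
    simp [walks]
  rw [this]
  refine (MeasurableSet.iInter fun i => ?_).inter (MeasurableSet.iInter fun i => ?_)
  · exact measurable_pi_apply i (MeasurableSet.of_discrete)
  · exact (by fun_prop : Measurable fun s : ℕ → ℕ => (s i, s (i + 1))) MeasurableSet.of_discrete

theorem IsAdmissible.ae_srw_mem_walks (hG : G.IsAdmissible M) {o : ℕ} (ho : o ∈ G.verts) :
    ∀ᵐ s ∂(G.srw o), s ∈ G.walks := by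
  filter_upwards [G.ae_srw_zero o, ae_all_iff.2 (G.ae_srw_step o)] with s h0 hs
  have key : ∀ i, s i ∈ G.verts →
      G.arc (s i) (s (i + 1)) ∨ ((∀ w, ¬ G.arc (s i) w) ∧ s (i + 1) = s i) := by
    intro i hi
    have := hs i
    rw [stepPMF_apply (hG.finite_arc hi)] at this
    split_ifs at this with h h' h''
    · exact Or.inl h'
    · simp at this
    · exact Or.inr ⟨fun w hw => h ⟨w, hw⟩, h''⟩
    · simp at this
  have hv : ∀ i, s i ∈ G.verts := by
    intro i
    induction i with
    | zero => rwa [h0]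
    | succ i ih =>
      rcases key i ih with h | ⟨_, h⟩
      · exact (G.arc_mem _ _ h).2
      · rwa [h]
  exact ⟨hv, fun i => key i (hv i)⟩

end Net

/-! ### The law of a network with a simple random walk -/

namespace WalkNetwork

variable {X : Type*} {M : ℕ}

theorem measurable_of_toNet_eq {Ω : Type*} [MeasurableSpace Ω] {G : Net X}
    {Φ : Ω → WalkNetwork X M} (hG : ∀ ω, (Φ ω).toNet = G)
    (hΦ : ∀ i, Measurable fun ω => (Φ ω).walk i) : Measurable Φ := by
  refine measurable_generateFrom ?_
  rintro _ ⟨g, n, w, -, -, rfl⟩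
  have : Φ ⁻¹' (cylinder X M g w) = ⋃ r : ℕ, (fun ω => fun i : Fin (n + 1) => (Φ ω).walk i) ⁻¹'
      {t : Fin (n + 1) → ℕ | (G.induce (G.ball (t 0) r)).Iso g t w} := by
    ext ω
    simp only [cylinder, mem_preimage, mem_iUnion, mem_ofPred_eq, hG]
    rfl
  rw [this]
  exact MeasurableSet.iUnion fun r =>
    (measurable_pi_lambda (fun ω (i : Fin (n + 1)) => (Φ ω).walk i) fun i => hΦ i)
      MeasurableSet.of_discrete

/-- The events that depend only on the ball of some radius `m` around the first vertex, together
with the first `m + 1` vertices of the walk, up to isomorphism. -/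
def ballEvents (X : Type*) (M : ℕ) : Set (Set (WalkNetwork X M)) :=
  {A | ∃ m : ℕ, ∀ x y : WalkNetwork X M, (x.toNet.induce (x.toNet.ball (x.walk 0) m)).Iso
      (y.toNet.induce (y.toNet.ball (y.walk 0) m)) (fun i : Fin (m + 1) => x.walk i)
      (fun i : Fin (m + 1) => y.walk i) → x ∈ A → y ∈ A}

theorem iso_ball_of_le {x y : WalkNetwork X M} {m n r s : ℕ} (hmn : m ≤ n) (hrs : r ≤ s)
    (h : (x.toNet.induce (x.toNet.ball (x.walk 0) s)).Iso
      (y.toNet.induce (y.toNet.ball (y.walk 0) s)) (fun i : Fin (n + 1) => x.walk i)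
      (fun i : Fin (n + 1) => y.walk i)) :
    (x.toNet.induce (x.toNet.ball (x.walk 0) r)).Iso
      (y.toNet.induce (y.toNet.ball (y.walk 0) r)) (fun i : Fin (m + 1) => x.walk i)
      (fun i : Fin (m + 1) => y.walk i) :=
  (h.restrict_ball (0 : Fin (n + 1)) (x.walk_mem.1 _) (y.walk_mem.1 _)
    (x.toNet.ball_mono _ hrs) (y.toNet.ball_mono _ hrs)).comp
      (Fin.castLE (Nat.succ_le_succ hmn))

theorem isPiSystem_ballEvents : IsPiSystem (ballEvents X M) := by
  rintro A ⟨m, hA⟩ B ⟨n, hB⟩ -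
  exact ⟨max m n, fun x y h hx =>
    ⟨hA x y (iso_ball_of_le (le_max_left _ _) (le_max_left _ _) h) hx.1,
      hB x y (iso_ball_of_le (le_max_right _ _) (le_max_right _ _) h) hx.2⟩⟩

theorem generateFrom_ballEvents [Countable X] [Nonempty X] :
    (inferInstance : MeasurableSpace (WalkNetwork X M)) =
      MeasurableSpace.generateFrom (ballEvents X M) := by
  refine le_antisymm (MeasurableSpace.generateFrom_le ?_) (MeasurableSpace.generateFrom_le ?_)
  · rintro _ ⟨g, n, w, -, -, rfl⟩
    have : cylinder X M g w = ⋃ r : ℕ, {x | (x.toNet.induce (x.toNet.ball (x.walk 0) r)).Iso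
        g (fun i : Fin (n + 1) => x.walk i) w} := by
      ext x
      simp only [mem_iUnion]
      rfl
    rw [this]
    refine MeasurableSet.iUnion fun r => MeasurableSpace.measurableSet_generateFrom
      ⟨max r n, fun x y h hx => ?_⟩
    exact (iso_ball_of_le (le_max_right _ _) (le_max_left _ _) h).symm.trans hx
  · rintro A ⟨m, hA⟩
    exact measurableSet_of_ball le_rfl hA

end WalkNetwork

namespace Net

variable {X : Type*} {M : ℕ}

open scoped Classical in
theorem srw_prefix_apply (G : Net X) (o : ℕ) {m : ℕ} (t : Fin (m + 1) → ℕ) :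
    G.srw o {s | (fun i : Fin (m + 1) => s i) = t} =
      (if t 0 = o then 1 else 0) * ∏ i : Fin m, G.stepPMF (t i.castSucc) (t i.succ) := by
  have := G.srw_initialCylinder o (fun i => if h : i < m + 1 then t ⟨i, h⟩ else 0) m
  rw [Finset.prod_range] at this
  have hset : {s : ℕ → ℕ | (fun i : Fin (m + 1) => s i) = t} =
      initialCylinder (fun i => if h : i < m + 1 then t ⟨i, h⟩ else 0) (m + 1) := by
    ext s
    simp only [initialCylinder, mem_ofPred_eq, funext_iff]
    constructor
    · intro h i hi
      rw [dif_pos hi]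
      exact h ⟨i, hi⟩
    · intro h i
      rw [h i i.2, dif_pos i.2]
  rw [hset, this]
  congr 1
  refine Finset.prod_congr rfl fun i _ => ?_
  have h1 : (i : ℕ) < m + 1 := by omega
  have h2 : (i : ℕ) + 1 < m + 1 := by omega
  simp only [h1, h2, dif_pos]
  rfl

open scoped Classical in
theorem srw_apply_eq_tsum (G : Net X) (o : ℕ) {m : ℕ} (Q : (Fin (m + 1) → ℕ) → Prop) :
    G.srw o {s | Q fun i : Fin (m + 1) => s i} =
      ∑' t, if Q t then (if t 0 = o then 1 else 0) *
        ∏ i : Fin m, G.stepPMF (t i.castSucc) (t i.succ) else 0 := by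
  have hm : Measurable fun (s : ℕ → ℕ) (i : Fin (m + 1)) => s i := by fun_prop
  have h : {s : ℕ → ℕ | Q fun i : Fin (m + 1) => s i} =
      (fun (s : ℕ → ℕ) (i : Fin (m + 1)) => s i) ⁻¹' {t | Q t} := rfl
  rw [h, ← Measure.map_apply hm MeasurableSet.of_discrete,
    ← Measure.tsum_indicator_apply_singleton _ _ MeasurableSet.of_discrete]
  refine tsum_congr fun t => ?_
  rw [indicator_apply]
  refine if_congr Iff.rfl ?_ rfl
  rw [Measure.map_apply hm MeasurableSet.of_discrete, ← srw_prefix_apply]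
  rfl

end Net

namespace RootedNetwork

variable {X : Type*} {M : ℕ}

theorem measurable_mk_walk (x : RootedNetwork X M) : Measurable
    (fun s : x.toNet.walks => (⟨x.toNet, x.admissible, s.1, s.2⟩ : WalkNetwork X M)) :=
  WalkNetwork.measurable_of_toNet_eq (fun _ => rfl)
    fun i => (measurable_pi_apply i).comp measurable_subtype_coe

theorem walkLaw_apply (x : RootedNetwork X M) {A : Set (WalkNetwork X M)} (hA : MeasurableSet A) :
    x.walkLaw A = x.toNet.srw x.root
      {s | ∃ h : s ∈ x.toNet.walks, (⟨x.toNet, x.admissible, s, h⟩ : WalkNetwork X M) ∈ A} := by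
  rw [walkLaw, Measure.map_apply x.measurable_mk_walk hA,
    (MeasurableEmbedding.subtype_coe x.toNet.measurableSet_walks).comap_apply]
  congr 1
  ext s
  simp

instance (x : RootedNetwork X M) : IsProbabilityMeasure x.walkLaw := by
  refine ⟨?_⟩
  rw [walkLaw_apply x MeasurableSet.univ]
  simp only [mem_univ, exists_prop, and_true]
  exact prob_compl_eq_zero_iff x.toNet.measurableSet_walks |>.1
    (x.admissible.ae_srw_mem_walks x.root_mem)

open scoped Classical in
/-- The law of the first `m` steps of the walk is determined by the ball of radius `m + 1`. -/
theorem walkLaw_eq_of_iso_ball {A : Set (WalkNetwork X M)} (hAm : MeasurableSet A) {m : ℕ}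
    (hA : ∀ x y : WalkNetwork X M, (x.toNet.induce (x.toNet.ball (x.walk 0) m)).Iso
      (y.toNet.induce (y.toNet.ball (y.walk 0) m)) (fun i : Fin (m + 1) => x.walk i)
      (fun i : Fin (m + 1) => y.walk i) → x ∈ A → y ∈ A)
    {x y : RootedNetwork X M} (hxy : (x.toNet.induce (x.toNet.ball x.root (m + 1))).Iso
      (y.toNet.induce (y.toNet.ball y.root (m + 1))) (fun _ : Unit => x.root)
      (fun _ => y.root)) : x.walkLaw A = y.walkLaw A := by
  -- `Q z t`: some member of `A` looks like `z` with the walk starting with `t`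
  let Q : RootedNetwork X M → (Fin (m + 1) → ℕ) → Prop := fun z t => ∃ a ∈ A,
    (a.toNet.induce (a.toNet.ball (a.walk 0) m)).Iso (z.toNet.induce (z.toNet.ball z.root m))
      (fun i : Fin (m + 1) => a.walk i) t
  have hQ : ∀ z : RootedNetwork X M, z.walkLaw A =
      ∑' t, if Q z t then (if t 0 = z.root then 1 else 0) *
        ∏ i : Fin m, z.toNet.stepPMF (t i.castSucc) (t i.succ) else 0 := by
    intro z
    rw [walkLaw_apply z hAm, ← Net.srw_apply_eq_tsum]
    refine measure_congr ?_
    filter_upwards [z.toNet.ae_srw_zero z.root, z.admissible.ae_srw_mem_walks z.root_mem]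
      with s h0 hs
    refine propext ⟨?_, ?_⟩
    · rintro ⟨h, hz⟩
      refine ⟨_, hz, ?_⟩
      rw [← h0]
      exact Net.Iso.refl _ _
    · rintro ⟨a, ha, hiso⟩
      refine ⟨hs, hA a _ ?_ ha⟩
      rw [← h0] at hiso
      exact hiso
  have hQmem : ∀ z t, Q z t → ∀ i, t i ∈ z.toNet.ball z.root m := by
    rintro z t ⟨a, -, f, -, -, h3⟩ i
    have hi : a.walk i ∈ (a.toNet.induce (a.toNet.ball (a.walk 0) m)).verts :=
      ⟨a.walk_mem.1 _, a.toNet.ball_mono _ (Nat.le_of_lt_succ i.2) (a.walk_mem_ball i)⟩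
    rw [← (h3 ⟨_, hi⟩ i).1 rfl]
    exact (f ⟨_, hi⟩).2.2
  obtain ⟨f, h1, h2, h3⟩ := hxy
  have hinj : ∀ z : RootedNetwork X M, Function.Injective
      (fun (t : Fin (m + 1) → (z.toNet.induce (z.toNet.ball z.root (m + 1))).verts)
        (i : Fin (m + 1)) => (t i : ℕ)) := fun z t t' h =>
    funext fun i => Subtype.ext (congrFun h i)
  have hsupp : ∀ z : RootedNetwork X M, Function.support (fun t : Fin (m + 1) → ℕ =>
      if Q z t then (if t 0 = z.root then (1 : ENNReal) else 0) *
        ∏ i : Fin m, z.toNet.stepPMF (t i.castSucc) (t i.succ) else 0) ⊆ range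
      (fun (t : Fin (m + 1) → (z.toNet.induce (z.toNet.ball z.root (m + 1))).verts)
        (i : Fin (m + 1)) => (t i : ℕ)) := by
    intro z t ht
    have hQt : Q z t := by
      by_contra h
      exact ht (if_neg h)
    exact ⟨fun i => ⟨t i, (hQmem z t hQt i).1,
      z.toNet.ball_mono _ (Nat.le_succ m) (hQmem z t hQt i)⟩, rfl⟩
  rw [hQ, hQ, ← (hinj x).tsum_eq (hsupp x), ← (hinj y).tsum_eq (hsupp y),
    ← (Equiv.piCongrRight fun _ : Fin (m + 1) => f).tsum_eq]
  refine tsum_congr fun t => ?_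
  simp only [Equiv.piCongrRight_apply, Pi.map_apply]
  have hballs : (x.toNet.induce (x.toNet.ball x.root m)).Iso
      (y.toNet.induce (y.toNet.ball y.root m)) (fun i => (t i : ℕ)) (fun i => (f (t i) : ℕ)) := by
    have h4 : (x.toNet.induce (x.toNet.ball x.root (m + 1))).Iso
        (y.toNet.induce (y.toNet.ball y.root (m + 1)))
        (fun i : Option (Fin (m + 1)) => i.elim x.root (fun i => (t i : ℕ)))
        (fun i => i.elim y.root (fun i => (f (t i) : ℕ))) := by
      refine ⟨f, h1, h2, fun u i => ?_⟩
      cases i with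
      | none => exact h3 u ()
      | some i => simp only [Option.elim_some, Subtype.coe_inj, f.injective.eq_iff]
    exact (h4.restrict_ball none x.root_mem y.root_mem (x.toNet.ball_mono _ (Nat.le_succ m))
      (y.toNet.ball_mono _ (Nat.le_succ m))).comp some
  have hQiff : Q x (fun i => (t i : ℕ)) ↔ Q y (fun i => (f (t i) : ℕ)) :=
    exists_congr fun a => and_congr_right fun _ =>
      ⟨fun h => h.trans hballs, fun h => h.trans hballs.symm⟩
  by_cases hq : Q x (fun i => (t i : ℕ))
  · have hq' := hQiff.1 hq
    rw [if_pos hq, if_pos hq']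
    refine congrArg₂ _ (if_congr (h3 (t 0) ()) rfl rfl) (Finset.prod_congr rfl fun i _ => ?_)
    refine Net.stepPMF_eq_of_equiv f h1 _ _ (x.admissible.finite_arc (t _).2.1)
      (y.admissible.finite_arc (f (t _)).2.1) (fun w hw => ?_) (fun w hw => ?_)
    · exact Net.mem_ball_succ.2 (Or.inr ⟨_, hQmem x _ hq _, Or.inl hw⟩)
    · exact Net.mem_ball_succ.2 (Or.inr ⟨_, hQmem y _ hq' _, Or.inl hw⟩)
  · rw [if_neg hq, if_neg (fun h => hq (hQiff.2 h))]

theorem measurable_walkLaw [Countable X] [Nonempty X] :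
    Measurable (walkLaw : RootedNetwork X M → Measure (WalkNetwork X M)) := by
  refine Measurable.measure_of_isPiSystem_of_isProbabilityMeasure
    WalkNetwork.generateFrom_ballEvents WalkNetwork.isPiSystem_ballEvents ?_
  rintro A ⟨m, hA⟩
  have hAm : MeasurableSet A := WalkNetwork.measurableSet_of_ball le_rfl hA
  intro S hS
  refine measurableSet_of_ball (P := fun x => x.walkLaw A ∈ S) (m + 1) fun x y h hx => ?_
  rwa [← walkLaw_eq_of_iso_ball hAm hA h]

/-- The transition kernel from a rooted network to the network with a simple random walk. -/
noncomputable def walkKernel (X : Type*) (M : ℕ) [Countable X] [Nonempty X] :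
    Kernel (RootedNetwork X M) (WalkNetwork X M) := ⟨walkLaw, measurable_walkLaw⟩

instance [Countable X] [Nonempty X] : IsMarkovKernel (walkKernel X M) :=
  ⟨fun x => inferInstanceAs (IsProbabilityMeasure x.walkLaw)⟩

theorem measurable_walkLaw_prod [Countable X] [Nonempty X] :
    Measurable fun p : RootedNetwork X M × RootedNetwork X M => p.1.walkLaw.prod p.2.walkLaw := by
  convert! (walkKernel X M ∥ₖ walkKernel X M).measurable using 1
  funext p
  rw [Kernel.parallelComp_apply]
  rfl

end RootedNetwork

section Laws

variable {X : Type*} {M : ℕ} [Countable X] [Nonempty X]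

theorem fst_pairWithWalks (ρ : Measure (RootedNetwork X M × RootedNetwork X M)) :
    (pairWithWalks ρ).fst = withWalk ρ.fst := by
  ext A hA
  rw [Measure.fst_apply hA, pairWithWalks,
    Measure.bind_apply (measurable_fst hA) RootedNetwork.measurable_walkLaw_prod.aemeasurable,
    withWalk, Measure.bind_apply hA RootedNetwork.measurable_walkLaw.aemeasurable, Measure.fst]
  refine Eq.trans ?_ (lintegral_map (f := fun x : RootedNetwork X M => x.walkLaw A)
    ((Measure.measurable_coe hA).comp RootedNetwork.measurable_walkLaw) measurable_fst).symm
  refine lintegral_congr fun p => ?_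
  rw [← prod_univ, Measure.prod_prod, measure_univ, mul_one]

theorem fst_mem_ergodicLaws {U : Set (RootedNetwork X M)}
    {ρ : Measure (RootedNetwork X M × RootedNetwork X M)} (hρ : ρ ∈ ergodicPairLaws U)
    (hU : ∀ᵐ x ∂ρ.fst, x ∈ U) : ρ.fst ∈ ergodicLaws U := by
  obtain ⟨h1, h2, -⟩ := hρ
  exact ⟨inferInstance,
    MeasurePreserving.ergodic_of_ergodic_semiconj (g := Prod.fst)
      ⟨measurable_fst, fst_pairWithWalks ρ⟩ h2 WalkNetwork.measurable_shift fun _ => rfl, hU⟩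

end Laws

/-! ### Skew products over a Bernoulli shift -/

/-- The sequence `e, ω 0, ω 1, …`. -/
def seqCons {E : Type*} (e : E) (ω : ℕ → E) : ℕ → E
  | 0 => e
  | n + 1 => ω n

/-- The law of a sequence of independent uniform elements of `E`. -/
noncomputable def uniformSeq (E : Type*) [Fintype E] [Nonempty E] [MeasurableSpace E] :
    Measure (ℕ → E) :=
  Measure.infinitePi fun _ => (PMF.uniformOfFintype E).toMeasure

section Bernoulli

variable {E : Type*} [Fintype E] [Nonempty E] [MeasurableSpace E] [MeasurableSingletonClass E]

instance : IsProbabilityMeasure (uniformSeq E) := by unfold uniformSeq; infer_instance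

theorem measurable_seqCons {E : Type*} [MeasurableSpace E] (e : E) : Measurable (seqCons e) := by
  refine measurable_pi_lambda _ fun n => ?_
  cases n with
  | zero => exact measurable_const
  | succ n => exact measurable_pi_apply n

theorem uniformSeq_initialCylinder (t : ℕ → E) (n : ℕ) :
    uniformSeq E (initialCylinder t n) = ((Fintype.card E : ENNReal)⁻¹) ^ n := by
  have : initialCylinder t n = Set.pi (Finset.range n : Finset ℕ) fun i => {t i} := by
    ext s
    simp [initialCylinder]
  rw [this, uniformSeq, Measure.infinitePi_pi _ fun _ _ => measurableSet_singleton _]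
  simp [PMF.toMeasure_apply_singleton _ _ (measurableSet_singleton _)]

theorem mem_initialCylinder_succ {E : Type*} {t : ℕ → E} {n : ℕ} {e : E} {ω : ℕ → E} :
    seqCons e ω ∈ initialCylinder t (n + 1) ↔
      e = t 0 ∧ ω ∈ initialCylinder (fun i => t (i + 1)) n := by
  constructor
  · intro h
    exact ⟨h 0 (Nat.succ_pos n), fun i hi => h (i + 1) (Nat.succ_lt_succ hi)⟩
  · rintro ⟨h0, h⟩ i hi
    cases i with
    | zero => exact h0
    | succ i => exact h i (Nat.lt_of_succ_lt_succ hi)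

/-- A sequence of independent uniform elements arises by putting a further uniform element in
front of such a sequence. -/
theorem uniformSeq_eq_sum_map :
    uniformSeq E = (Fintype.card E : ENNReal)⁻¹ • ∑ e, (uniformSeq E).map (seqCons e) := by
  classical
  have hcard : (Fintype.card E : ENNReal)⁻¹ * Fintype.card E = 1 :=
    ENNReal.inv_mul_cancel (by simp) (by simp)
  refine Measure.ext_of_initialCylinder fun t n => ?_
  simp only [Measure.smul_apply, Measure.finsetSum_apply, smul_eq_mul,
    Measure.map_apply (measurable_seqCons _) (measurableSet_initialCylinder t n)]
  cases n with
  | zero => simp [initialCylinder, hcard]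
  | succ n =>
    have : ∀ e : E, uniformSeq E (seqCons e ⁻¹' (initialCylinder t (n + 1))) =
        if e = t 0 then ((Fintype.card E : ENNReal)⁻¹) ^ n else 0 := by
      intro e
      split_ifs with h
      · rw [← uniformSeq_initialCylinder fun i => t (i + 1)]
        congr 1
        ext ω
        rw [mem_preimage, mem_initialCylinder_succ]
        simp [h]
      · convert! measure_empty (μ := uniformSeq E)
        ext ω
        rw [mem_preimage, mem_initialCylinder_succ]
        simp [h]
    simp only [this, Finset.sum_ite_eq', Finset.mem_univ, if_true, uniformSeq_initialCylinder,
      pow_succ']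

theorem uniformSeq_apply {A : Set (ℕ → E)} (hA : MeasurableSet A) :
    uniformSeq E A =
      (Fintype.card E : ENNReal)⁻¹ * ∑ e, uniformSeq E {ω | seqCons e ω ∈ A} := by
  conv_lhs => rw [uniformSeq_eq_sum_map]
  simp only [Measure.smul_apply, Measure.finsetSum_apply, smul_eq_mul,
    Measure.map_apply (measurable_seqCons _) hA]
  rfl

theorem map_uniformSeq_prod {E' : Type*} [Fintype E'] [Nonempty E'] [MeasurableSpace E']
    [MeasurableSingletonClass E'] :
    (uniformSeq (E × E')).map (fun ω => (fun n => (ω n).1, fun n => (ω n).2)) =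
      (uniformSeq E).prod (uniformSeq E') := by
  have hzip : Measurable fun (p : (ℕ → E) × (ℕ → E')) (n : ℕ) => (p.1 n, p.2 n) := by fun_prop
  have : ((uniformSeq E).prod (uniformSeq E')).map (fun p n => (p.1 n, p.2 n)) =
      uniformSeq (E × E') := by
    have : IsFiniteMeasure (((uniformSeq E).prod (uniformSeq E')).map
      (fun p n => (p.1 n, p.2 n))) := Measure.isFiniteMeasure_map _ _
    refine Measure.ext_of_initialCylinder fun t n => ?_
    rw [Measure.map_apply hzip (measurableSet_initialCylinder t n), uniformSeq_initialCylinder]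
    have : (fun (p : (ℕ → E) × (ℕ → E')) (n : ℕ) => (p.1 n, p.2 n)) ⁻¹' (initialCylinder t n) =
        initialCylinder (fun i => (t i).1) n ×ˢ initialCylinder (fun i => (t i).2) n := by
      ext p
      simp only [initialCylinder, mem_preimage, mem_ofPred_eq, mem_prod, Prod.ext_iff]
      exact ⟨fun h => ⟨fun i hi => (h i hi).1, fun i hi => (h i hi).2⟩,
        fun h i hi => ⟨h.1 i hi, h.2 i hi⟩⟩
    rw [this, Measure.prod_prod, uniformSeq_initialCylinder, uniformSeq_initialCylinder,
      ← mul_pow, Fintype.card_prod, Nat.cast_mul, ENNReal.mul_inv (by simp) (by simp)]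
  rw [← this, Measure.map_map (by fun_prop) hzip]
  exact Measure.map_id

end Bernoulli

section SkewProduct

variable {E F : Type*} [Fintype E] [Nonempty E] [MeasurableSpace E] [MeasurableSingletonClass E]
  [Finite F] [MeasurableSpace F] [MeasurableSingletonClass F]
  {π : Measure F} {τ : E → F → F}

theorem measurable_skewProduct {E F : Type*} [Countable E] [MeasurableSpace E]
    [MeasurableSingletonClass E] [Countable F] [MeasurableSpace F] [MeasurableSingletonClass F]
    (τ : E → F → F) :
    Measurable fun p : F × (ℕ → E) => (τ (p.2 0) p.1, fun n => p.2 (n + 1)) := by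
  refine Measurable.prodMk ?_ (by fun_prop)
  exact (measurable_of_countable (fun q : E × F => τ q.1 q.2)).comp
    (by fun_prop : Measurable fun p : F × (ℕ → E) => (p.2 0, p.1))

theorem uniformSeq_section_skewProduct (τ : E → F → F) {A : Set (F × (ℕ → E))}
    (hA : MeasurableSet A) (f : F) :
    uniformSeq E {ω | (τ (ω 0) f, fun n => ω (n + 1)) ∈ A} =
      (Fintype.card E : ENNReal)⁻¹ * ∑ e, uniformSeq E {ω | (τ e f, ω) ∈ A} :=
  uniformSeq_apply (measurable_prodMk_left (measurable_skewProduct τ hA))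

theorem prod_uniformSeq_preimage_skewProduct (hτ : ∀ e, MeasurePreserving (τ e) π π)
    {A : Set (F × (ℕ → E))} (hA : MeasurableSet A) :
    π.prod (uniformSeq E) {p | (τ (p.2 0) p.1, fun n => p.2 (n + 1)) ∈ A} =
      π.prod (uniformSeq E) A := by
  have hcard : (Fintype.card E : ENNReal)⁻¹ * Fintype.card E = 1 :=
    ENNReal.inv_mul_cancel (by simp) (by simp)
  have hA' : MeasurableSet
      {p : F × (ℕ → E) | (τ (p.2 0) p.1, fun n => p.2 (n + 1)) ∈ A} := measurable_skewProduct τ hA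
  rw [Measure.prod_apply hA', Measure.prod_apply hA]
  have h1 : ∀ f : F, uniformSeq E (Prod.mk f ⁻¹'
      {p : F × (ℕ → E) | (τ (p.2 0) p.1, fun n => p.2 (n + 1)) ∈ A}) =
      (Fintype.card E : ENNReal)⁻¹ * ∑ e, uniformSeq E (Prod.mk (τ e f) ⁻¹' A) :=
    uniformSeq_section_skewProduct τ hA
  have h2 : ∀ e, ∫⁻ f, uniformSeq E (Prod.mk (τ e f) ⁻¹' A) ∂π =
      ∫⁻ f, uniformSeq E (Prod.mk f ⁻¹' A) ∂π := fun e =>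
    (hτ e).lintegral_comp (f := fun f => uniformSeq E (Prod.mk f ⁻¹' A))
      (measurable_of_countable _)
  simp_rw [h1]
  rw [lintegral_const_mul _ (measurable_of_countable _),
    lintegral_finsetSum _ fun e _ => measurable_of_countable _]
  simp only [h2, Finset.sum_const, Finset.card_univ, nsmul_eq_mul, ← mul_assoc, hcard, one_mul]

/-- Invariant sets of a skew product over a Bernoulli shift with a finite fibre, on which the maps
`τ e` act transitively, are trivial. The measures of the sections of such a set form a harmonic
function on the fibre, which is constant by the maximum principle; hence every section is
independent of every cylinder set, and so of itself. -/
theorem prod_uniformSeq_eq_zero_or_one [IsProbabilityMeasure π]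
    (hτ : ∀ f f', Relation.ReflTransGen (fun a b => ∃ e, b = τ e a) f f')
    {A : Set (F × (ℕ → E))} (hA : MeasurableSet A)
    (hinv : ∀ f ω, (τ (ω 0) f, fun n => ω (n + 1)) ∈ A ↔ (f, ω) ∈ A) :
    π.prod (uniformSeq E) A = 0 ∨ π.prod (uniformSeq E) A = 1 := by
  have hcard : (Fintype.card E : ENNReal)⁻¹ * Fintype.card E = 1 :=
    ENNReal.inv_mul_cancel (by simp) (by simp)
  have hF : Nonempty F := by
    by_contra h
    rw [not_nonempty_iff] at h
    exact IsProbabilityMeasure.ne_zero π (Measure.eq_zero_of_isEmpty π)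
  have hsec : ∀ f, MeasurableSet {ω | (f, ω) ∈ A} := fun f => measurable_prodMk_left hA
  have hmean : ∀ f, uniformSeq E {ω | (f, ω) ∈ A} =
      (Fintype.card E : ENNReal)⁻¹ * ∑ e, uniformSeq E {ω | (τ e f, ω) ∈ A} := by
    intro f
    rw [← uniformSeq_section_skewProduct τ hA f]
    simp only [hinv]
  obtain ⟨f₀, hf₀⟩ := Finite.exists_max fun f => uniformSeq E {ω | (f, ω) ∈ A}
  have hconst : ∀ f, uniformSeq E {ω | (f, ω) ∈ A} = uniformSeq E {ω | (f₀, ω) ∈ A} := by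
    intro f
    induction hτ f₀ f with
    | refl => rfl
    | @tail a b _ hab ih =>
      obtain ⟨e, rfl⟩ := hab
      refine le_antisymm (hf₀ _) ?_
      by_contra hlt
      rw [not_le] at hlt
      have hsum : ∑ e, uniformSeq E {ω | (τ e a, ω) ∈ A} <
          ∑ _e : E, uniformSeq E {ω | (f₀, ω) ∈ A} := by
        classical
        rw [← Finset.add_sum_erase _ _ (Finset.mem_univ e),
          ← Finset.add_sum_erase _ _ (Finset.mem_univ e)]
        exact ENNReal.add_lt_add_of_lt_of_le
          (ENNReal.sum_ne_top.2 fun _ _ => measure_ne_top _ _) hlt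
          (Finset.sum_le_sum fun _ _ => hf₀ _)
      have := ENNReal.mul_lt_mul_right (a := (Fintype.card E : ENNReal)⁻¹) (by simp) (by simp) hsum
      rw [← hmean, ih, Finset.sum_const, Finset.card_univ, nsmul_eq_mul, ← mul_assoc, hcard,
        one_mul] at this
      exact lt_irrefl _ this
  have hcyl : ∀ (n : ℕ) (t : ℕ → E) (f : F), uniformSeq E ({ω | (f, ω) ∈ A} ∩ initialCylinder t n) =
      uniformSeq E {ω | (f₀, ω) ∈ A} * uniformSeq E (initialCylinder t n) := by
    intro n
    induction n with
    | zero => intro t f; simp [initialCylinder, hconst f]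
    | succ n ih =>
      intro t f
      rw [uniformSeq_apply ((hsec f).inter (measurableSet_initialCylinder t (n + 1))),
        Finset.sum_eq_single (t 0)]
      · have : {ω | seqCons (t 0) ω ∈ {ω | (f, ω) ∈ A} ∩ initialCylinder t (n + 1)} =
            {ω | (τ (t 0) f, ω) ∈ A} ∩ initialCylinder (fun i => t (i + 1)) n := by
          ext ω
          have := hinv f (seqCons (t 0) ω)
          simp only [mem_ofPred_eq, mem_inter_iff, mem_initialCylinder_succ, true_and, ← this]
          rfl
        rw [this, ih, uniformSeq_initialCylinder, uniformSeq_initialCylinder, pow_succ']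
        ring
      · intro e _ he
        convert! measure_empty (μ := uniformSeq E)
        ext ω
        simp [mem_initialCylinder_succ, he]
      · simp
  have hindep : (uniformSeq E).restrict {ω | (f₀, ω) ∈ A} =
      uniformSeq E {ω | (f₀, ω) ∈ A} • uniformSeq E := by
    refine Measure.ext_of_initialCylinder fun t n => ?_
    rw [Measure.restrict_apply (measurableSet_initialCylinder t n), inter_comm, hcyl]
    rfl
  have hsq : uniformSeq E {ω | (f₀, ω) ∈ A} =
      uniformSeq E {ω | (f₀, ω) ∈ A} * uniformSeq E {ω | (f₀, ω) ∈ A} := by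
    have := congrArg (fun m => m {ω | (f₀, ω) ∈ A}) hindep
    simpa [Measure.restrict_apply (hsec f₀)] using this
  have hval : π.prod (uniformSeq E) A = uniformSeq E {ω | (f₀, ω) ∈ A} := by
    rw [Measure.prod_apply hA]
    have : ∀ f, uniformSeq E (Prod.mk f ⁻¹' A) = uniformSeq E {ω | (f₀, ω) ∈ A} := hconst
    simp [this]
  rw [hval]
  by_cases h0 : uniformSeq E {ω | (f₀, ω) ∈ A} = 0
  · exact Or.inl h0
  · right
    exact ((ENNReal.mul_eq_left h0 (measure_ne_top _ _)).1 hsq.symm)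

end SkewProduct

/-! ### Marked bi-infinite paths -/

section Paths

variable {X : Type*}

/-- The bi-infinite path with marks `s`; the integers are encoded as natural numbers. -/
def pathNet (s : ℤ → X) : Net X where
  verts := univ
  arc u v := Equiv.intEquivNat.symm v = Equiv.intEquivNat.symm u + 1 ∨
    Equiv.intEquivNat.symm v = Equiv.intEquivNat.symm u - 1
  mark v := s (Equiv.intEquivNat.symm v)
  arc_mem _ _ _ := ⟨trivial, trivial⟩
  arc_irrefl v h := by omega

theorem pathNet_arc_symm {s : ℤ → X} {u v : ℕ} (h : (pathNet s).arc u v) :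
    (pathNet s).arc v u := by
  simp only [pathNet] at h ⊢
  omega

theorem pathNet_setOf_arc (s : ℤ → X) (v : ℕ) : {w | (pathNet s).arc v w} =
    {Equiv.intEquivNat (Equiv.intEquivNat.symm v + 1),
      Equiv.intEquivNat (Equiv.intEquivNat.symm v - 1)} := by
  ext w
  simp only [pathNet, mem_ofPred_eq, mem_insert_iff, mem_singleton_iff, Equiv.symm_apply_eq]

theorem pathNet_encard_arc (s : ℤ → X) (v : ℕ) : {w | (pathNet s).arc v w}.encard = 2 := by
  rw [pathNet_setOf_arc, encard_pair]
  intro h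
  have := Equiv.intEquivNat.injective h
  omega

theorem pathNet_isAdmissible {M : ℕ} (hM : 2 ≤ M) (s : ℤ → X) : (pathNet s).IsAdmissible M := by
  have hreach : ∀ z : ℤ, (pathNet s).graph.Reachable (Equiv.intEquivNat 0)
      (Equiv.intEquivNat z) := by
    have hadj : ∀ z : ℤ, (pathNet s).graph.Adj (Equiv.intEquivNat z)
        (Equiv.intEquivNat (z + 1)) := fun z => by
      refine (SimpleGraph.fromRel_adj _ _ _).2 ⟨fun h => ?_, Or.inl (Or.inl (by simp))⟩
      have := Equiv.intEquivNat.injective h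
      omega
    intro z
    induction z using Int.induction_on with
    | zero => rfl
    | succ i ih => exact ih.trans (hadj _).reachable
    | pred i ih =>
      refine ih.trans (SimpleGraph.Adj.reachable (SimpleGraph.Adj.symm ?_))
      simpa using hadj (-i - 1)
  refine ⟨fun v _ => ?_, fun u _ v _ => ?_⟩
  · have : {w | (pathNet s).arc v w ∨ (pathNet s).arc w v} = {w | (pathNet s).arc v w} := by
      ext w
      exact or_iff_left_of_imp pathNet_arc_symm
    rw [this, pathNet_encard_arc]
    exact_mod_cast hM
  · simpa using (hreach (Equiv.intEquivNat.symm u)).symm.trans (hreach (Equiv.intEquivNat.symm v))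

theorem abs_sub_le_of_mem_ball_pathNet {s : ℤ → X} {o v r : ℕ} (h : v ∈ (pathNet s).ball o r) :
    |Equiv.intEquivNat.symm v - Equiv.intEquivNat.symm o| ≤ r := by
  induction r generalizing v with
  | zero =>
    rw [Net.ball_zero (G := pathNet s) (mem_univ o), mem_singleton_iff] at h
    simp [h]
  | succ r ih =>
    rcases Net.mem_ball_succ.1 h with h | ⟨u, hu, h⟩
    · have := ih h
      push_cast
      omega
    · have := ih hu
      have h' : (pathNet s).arc u v := h.elim id pathNet_arc_symm
      simp only [pathNet] at h'
      push_cast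
      rw [abs_le] at this ⊢
      omega

/-- The path with marks `s`, rooted at the vertex that encodes `0`. -/
def pathNetwork {M : ℕ} (hM : 2 ≤ M) (s : ℤ → X) : RootedNetwork X M where
  toNet := pathNet s
  admissible := pathNet_isAdmissible hM s
  root := Equiv.intEquivNat 0
  root_mem := trivial

theorem pathNetwork_isPath {M : ℕ} (hM : 2 ≤ M) (s : ℤ → X) : (pathNetwork hM s).IsPath :=
  ⟨infinite_univ, fun _ _ => pathNet_arc_symm, fun v _ => pathNet_encard_arc s v⟩

/-- A network whose balls look like those of a bi-infinite path is a bi-infinite path. -/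
theorem RootedNetwork.IsPath.of_iso_balls {M : ℕ} {x y : RootedNetwork X M} (hy : y.IsPath)
    (h : ∀ r, (x.toNet.induce (x.toNet.ball x.root r)).Iso
      (y.toNet.induce (y.toNet.ball y.root r)) (fun _ : Unit => x.root) (fun _ => y.root)) :
    x.IsPath := by
  refine ⟨fun hfin => ?_, fun u v huv => ?_, fun v hv => ?_⟩
  · obtain ⟨T, hT, hcard⟩ := hy.1.exists_subset_card_eq (x.verts.ncard + 1)
    choose! R hR using fun v (hv : v ∈ y.verts) => y.admissible.exists_mem_ball y.root_mem hv
    have hsub : (T : Set ℕ) ⊆ y.toNet.ball y.root (T.sup R) := fun v hv =>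
      y.toNet.ball_mono _ (Finset.le_sup (Finset.mem_coe.1 hv)) (hR v (hT hv))
    have h1 := ncard_le_ncard hsub (y.admissible.finite_ball y.root_mem _)
    have h2 := (h (T.sup R)).ncard_verts_eq
    rw [Net.induce_ball_verts, Net.induce_ball_verts] at h2
    have h3 := ncard_le_ncard (Net.ball_subset_verts (G := x.toNet) x.root (T.sup R)) hfin
    rw [ncard_coe_finset, hcard] at h1
    omega
  · obtain ⟨r, hr⟩ := x.admissible.exists_mem_ball x.root_mem (x.arc_mem u v huv).1
    have hr' : v ∈ x.toNet.ball x.root (r + 1) := Net.mem_ball_succ.2 (Or.inr ⟨u, hr, Or.inl huv⟩)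
    have hr := x.toNet.ball_mono x.root (Nat.le_succ r) hr
    obtain ⟨f, h1, -⟩ := h (r + 1)
    have h2 := (h1 ⟨u, hr.1, hr⟩ ⟨v, hr'.1, hr'⟩).1 ⟨hr, hr', huv⟩
    exact ((h1 ⟨v, hr'.1, hr'⟩ ⟨u, hr.1, hr⟩).2 ⟨h2.2.1, h2.1, hy.2.1 _ _ h2.2.2⟩).2.2
  · obtain ⟨r, hr⟩ := x.admissible.exists_mem_ball x.root_mem hv
    obtain ⟨f, h1, -, h3⟩ := h (r + 1)
    have hv' : v ∈ (x.toNet.induce (x.toNet.ball x.root (r + 1))).verts :=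
      ⟨hv, x.toNet.ball_mono _ (Nat.le_succ r) hr⟩
    have hfr := (Net.mem_ball_iff_of_equiv f h1 x.root_mem y.root_mem (fun u => h3 u ())
      (x.toNet.ball_mono _ (Nat.le_succ r)) (y.toNet.ball_mono _ (Nat.le_succ r)) ⟨v, hv'⟩).1 hr
    obtain ⟨e⟩ := Net.nonempty_arc_equiv f h1 ⟨v, hv'⟩
      (fun w hw => Net.mem_ball_succ.2 (Or.inr ⟨v, hr, Or.inl hw⟩))
      (fun w hw => Net.mem_ball_succ.2 (Or.inr ⟨_, hfr, Or.inl hw⟩))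
    rw [← hy.2.2 _ (f ⟨v, hv'⟩).2.1]
    exact Set.encard_congr e

/-! ### The simple random walk on a marked path -/

/-- The increment of a walk on the integers coded by a bit. -/
def bitStep (b : Bool) : ℤ := if b then 1 else -1

/-- The position at time `n` of the walk from `0` with the increments coded by `ε`. -/
def bitWalk (ε : ℕ → Bool) : ℕ → ℤ
  | 0 => 0
  | n + 1 => bitWalk ε n + bitStep (ε n)

theorem bitWalk_succ' (ε : ℕ → Bool) (n : ℕ) :
    bitWalk ε (n + 1) = bitStep (ε 0) + bitWalk (fun i => ε (i + 1)) n := by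
  induction n with
  | zero => simp [bitWalk]
  | succ n ih => rw [bitWalk, ih, bitWalk, add_assoc]

theorem abs_bitWalk_le (ε : ℕ → Bool) (n : ℕ) : |bitWalk ε n| ≤ n := by
  induction n with
  | zero => simp [bitWalk]
  | succ n ih =>
    have : bitStep (ε n) = 1 ∨ bitStep (ε n) = -1 := by cases ε n <;> simp [bitStep]
    rw [bitWalk, abs_le] at *
    push_cast
    omega

theorem measurable_bitWalk (n : ℕ) : Measurable fun ε => bitWalk ε n := by
  induction n with
  | zero => exact measurable_const
  | succ n ih => exact ih.add ((measurable_of_countable bitStep).comp (measurable_pi_apply n))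

/-- The path with marks `s` and the walk from the root with the increments coded by `ε`. -/
def pathWalk {M : ℕ} (hM : 2 ≤ M) (s : ℤ → X) (ε : ℕ → Bool) : WalkNetwork X M where
  toNet := pathNet s
  admissible := pathNet_isAdmissible hM s
  walk n := Equiv.intEquivNat (bitWalk ε n)
  walk_mem := by
    refine ⟨fun _ => trivial, fun i => Or.inl ?_⟩
    simp only [pathNet, Equiv.symm_apply_apply, bitWalk, bitStep]
    cases ε i <;> simp [sub_eq_add_neg]

theorem measurable_pathWalk {M : ℕ} (hM : 2 ≤ M) (s : ℤ → X) :
    Measurable (pathWalk hM s) :=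
  WalkNetwork.measurable_of_toNet_eq (fun _ => rfl)
    fun i => (measurable_of_countable Equiv.intEquivNat).comp (measurable_bitWalk i)

theorem pathNet_stepPMF (s : ℤ → X) (z : ℤ) (w : ℕ) :
    (pathNet s).stepPMF (Equiv.intEquivNat z) w =
      2⁻¹ * ∑ b, if w = Equiv.intEquivNat (z + bitStep b) then 1 else 0 := by
  classical
  have hfin : {w | (pathNet s).arc (Equiv.intEquivNat z) w}.Finite :=
    Set.finite_of_encard_eq_coe (pathNet_encard_arc s _)
  have hcard : Nat.card {w | (pathNet s).arc (Equiv.intEquivNat z) w} = 2 := by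
    rw [Nat.card_coe_set_eq, ncard, pathNet_encard_arc]
    rfl
  have hne : {w | (pathNet s).arc (Equiv.intEquivNat z) w}.Nonempty := by
    rw [pathNet_setOf_arc]
    exact insert_nonempty _ _
  have harc : (pathNet s).arc (Equiv.intEquivNat z) w ↔
      w = Equiv.intEquivNat (z + 1) ∨ w = Equiv.intEquivNat (z + -1) := by
    have := Set.ext_iff.1 (pathNet_setOf_arc s (Equiv.intEquivNat z)) w
    simpa [sub_eq_add_neg] using this
  have hdis : ¬ (w = Equiv.intEquivNat (z + 1) ∧ w = Equiv.intEquivNat (z + -1)) := by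
    rintro ⟨h, h'⟩
    have := Equiv.intEquivNat.injective (h.symm.trans h')
    omega
  rw [Net.stepPMF_apply hfin, if_pos hne, hcard]
  simp only [harc, Fintype.sum_bool, bitStep]
  by_cases h1 : w = Equiv.intEquivNat (z + 1)
  · have h2 : ¬ w = Equiv.intEquivNat (z + -1) := fun h => hdis ⟨h1, h⟩
    simp [← h1, h2]
  · by_cases h2 : w = Equiv.intEquivNat (z + -1)
    · simp [← h2, h1]
    · simp [h1, h2]

theorem uniformSeq_bitWalk (s : ℤ → X) (n : ℕ) (z : ℤ) (t : ℕ → ℕ) :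
    uniformSeq Bool {ε | (fun i => Equiv.intEquivNat (z + bitWalk ε i)) ∈
      initialCylinder t (n + 1)} = (if t 0 = Equiv.intEquivNat z then 1 else 0) *
        ∏ i ∈ Finset.range n, (pathNet s).stepPMF (t i) (t (i + 1)) := by
  have hmeas : ∀ n z t, MeasurableSet {ε : ℕ → Bool |
      (fun i => Equiv.intEquivNat (z + bitWalk ε i)) ∈ initialCylinder t n} := fun n z t =>
    (measurable_pi_lambda _ fun i => (measurable_of_countable
      (fun y => Equiv.intEquivNat (z + y))).comp (measurable_bitWalk i))
      (measurableSet_initialCylinder t n)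
  induction n generalizing z t with
  | zero =>
    by_cases h : t 0 = Equiv.intEquivNat z
    · simp [initialCylinder, bitWalk, h]
    · simp [initialCylinder, bitWalk, h, Ne.symm h]
  | succ n ih =>
    have hcons : ∀ b ε, seqCons b ε ∈ {ε | (fun i => Equiv.intEquivNat (z + bitWalk ε i)) ∈
        initialCylinder t (n + 1 + 1)} ↔ t 0 = Equiv.intEquivNat z ∧
        (fun i => Equiv.intEquivNat (z + bitStep b + bitWalk ε i)) ∈
          initialCylinder (fun i => t (i + 1)) (n + 1) := by
      intro b ε
      have hw : ∀ i, z + bitWalk (seqCons b ε) (i + 1) = z + bitStep b + bitWalk ε i := fun i => by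
        rw [bitWalk_succ', add_assoc]
        rfl
      constructor
      · intro h
        refine ⟨by simpa [bitWalk] using (h 0 (Nat.succ_pos _)).symm, fun i hi => ?_⟩
        have := h (i + 1) (Nat.succ_lt_succ hi)
        simpa only [hw] using this
      · rintro ⟨h0, h⟩ i hi
        cases i with
        | zero => simpa [bitWalk] using h0.symm
        | succ i =>
          simp only [hw]
          exact h i (Nat.lt_of_succ_lt_succ hi)
    rw [uniformSeq_apply (hmeas _ _ _)]
    simp only [hcons]
    by_cases h0 : t 0 = Equiv.intEquivNat z
    · simp only [h0, true_and, if_true, one_mul]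
      rw [Finset.prod_range_succ', h0, pathNet_stepPMF]
      have h2 : ∀ b, uniformSeq Bool {ε | (fun i => Equiv.intEquivNat (z + bitStep b + bitWalk ε i)) ∈
          initialCylinder (fun i => t (i + 1)) (n + 1)} = _ := fun b => ih _ _
      simp only [h2, ← Finset.sum_mul, zero_add, Fintype.card_bool, Nat.cast_ofNat]
      ring
    · simp [h0]

theorem pathNet_srw (s : ℤ → X) (z : ℤ) : (pathNet s).srw (Equiv.intEquivNat z) =
    (uniformSeq Bool).map fun ε i => Equiv.intEquivNat (z + bitWalk ε i) := by
  have hmeas : Measurable fun (ε : ℕ → Bool) i => Equiv.intEquivNat (z + bitWalk ε i) :=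
    measurable_pi_lambda _ fun i => (measurable_of_countable
      (fun y => Equiv.intEquivNat (z + y))).comp (measurable_bitWalk i)
  refine Measure.ext_of_initialCylinder fun t n => ?_
  rw [Measure.map_apply hmeas (measurableSet_initialCylinder t n)]
  cases n with
  | zero => simp [initialCylinder]
  | succ n =>
    rw [Net.srw_initialCylinder]
    exact (uniformSeq_bitWalk s n z t).symm

theorem walkLaw_pathNetwork {M : ℕ} (hM : 2 ≤ M) (s : ℤ → X) :
    (pathNetwork hM s).walkLaw = (uniformSeq Bool).map (pathWalk hM s) := by
  have hmeas : Measurable fun (ε : ℕ → Bool) i => Equiv.intEquivNat (0 + bitWalk ε i) :=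
    measurable_pi_lambda _ fun i => (measurable_of_countable
      (fun y => Equiv.intEquivNat (0 + y))).comp (measurable_bitWalk i)
  ext A hA
  rw [RootedNetwork.walkLaw_apply _ hA, Measure.map_apply (measurable_pathWalk hM s) hA]
  change (pathNet s).srw (Equiv.intEquivNat 0) _ = _
  have hset : MeasurableSet {w | ∃ h : w ∈ (pathNetwork hM s).toNet.walks,
      (⟨(pathNetwork hM s).toNet, (pathNetwork hM s).admissible, w, h⟩ : WalkNetwork X M) ∈ A} := by
    convert! ((pathNetwork hM s).toNet.measurableSet_walks).subtype_image
      ((pathNetwork hM s).measurable_mk_walk hA) using 1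
    ext w
    exact ⟨fun ⟨h, hw⟩ => ⟨⟨w, h⟩, hw, rfl⟩, by rintro ⟨⟨w, h⟩, hw, rfl⟩; exact ⟨h, hw⟩⟩
  rw [pathNet_srw, Measure.map_apply hmeas hset]
  congr 1
  ext ε
  simp only [mem_preimage, mem_ofPred_eq, zero_add]
  exact ⟨fun ⟨_, h⟩ => h, fun h => ⟨(pathWalk hM s ε).walk_mem, h⟩⟩

/-- Shifting the walk amounts, up to isomorphism, to shifting the marks. -/
theorem iso_shift_pathWalk {M : ℕ} (hM : 2 ≤ M) (s : ℤ → X) (ε : ℕ → Bool) :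
    (pathWalk hM s ε).shift.toNet.Iso
      (pathWalk hM (fun z => s (z + bitStep (ε 0))) fun i => ε (i + 1)).toNet
      (pathWalk hM s ε).shift.walk
      (pathWalk hM (fun z => s (z + bitStep (ε 0))) fun i => ε (i + 1)).walk := by
  let g : ℕ ≃ ℕ := Equiv.intEquivNat.symm.trans
    ((Equiv.subRight (bitStep (ε 0))).trans Equiv.intEquivNat)
  have hg : ∀ u, Equiv.intEquivNat.symm (g u) = Equiv.intEquivNat.symm u - bitStep (ε 0) :=
    fun u => by simp [g]
  refine ⟨⟨fun u => ⟨g u, trivial⟩, fun u => ⟨g.symm u, trivial⟩, fun u => by simp,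
    fun u => by simp⟩, fun u v => ?_, fun u => ?_, fun u i => ?_⟩
  · change (_ = _ + 1 ∨ _ = _ - 1) ↔ (Equiv.intEquivNat.symm (g v) =
      Equiv.intEquivNat.symm (g u) + 1 ∨ Equiv.intEquivNat.symm (g v) =
        Equiv.intEquivNat.symm (g u) - 1)
    rw [hg, hg]
    omega
  · change s _ = s (Equiv.intEquivNat.symm (g u) + bitStep (ε 0))
    rw [hg, sub_add_cancel]
  · change (u : ℕ) = Equiv.intEquivNat (bitWalk ε (i + 1)) ↔
      g u = Equiv.intEquivNat (bitWalk (fun i => ε (i + 1)) i)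
    rw [← Equiv.symm_apply_eq, ← Equiv.symm_apply_eq, hg, bitWalk_succ', sub_eq_iff_eq_add']

theorem iso_sample_pathWalk {M : ℕ} (hM : 2 ≤ M) {s a : ℤ → X} (k : ℕ → ℕ) (n : ℕ)
    (h : ∀ z : ℤ, |z| ≤ n + k n → s z = a z) (ε : ℕ → Bool) :
    ((pathWalk hM s ε).sample k n).toNet.Iso ((pathWalk hM a ε).sample k n).toNet
      ((pathWalk hM s ε).sample k n).walk ((pathWalk hM a ε).sample k n).walk := by
  refine ⟨Equiv.refl _, fun _ _ => Iff.rfl, ?_, fun _ _ => Iff.rfl⟩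
  rintro ⟨u, -, i, hu⟩
  refine h _ ?_
  have h1 := abs_sub_le_of_mem_ball_pathNet hu
  have h2 := abs_bitWalk_le ε i
  have h3 := i.2
  simp only [pathWalk, Equiv.symm_apply_apply] at h1
  change |Equiv.intEquivNat.symm u| ≤ _
  rw [abs_le] at *
  omega

end Paths

/-! ### Paths with randomly shifted marks -/

section Phases

variable {X : Type*} {M : ℕ} {F : Type*} [MeasurableSpace F]

/-- The law of the path with marks `s f` when the phase `f` is drawn from `π`. -/
noncomputable def phaseLaw (hM : 2 ≤ M) (π : Measure F) (s : F → ℤ → X) :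
    Measure (RootedNetwork X M) :=
  π.map fun f => pathNetwork hM (s f)

/-- The joint law of the paths with marks `s f` and `t f` when the phase `f` is drawn from `π`. -/
noncomputable def pairPhaseLaw (hM : 2 ≤ M) (π : Measure F) (s t : F → ℤ → X) :
    Measure (RootedNetwork X M × RootedNetwork X M) :=
  π.map fun f => (pathNetwork hM (s f), pathNetwork hM (t f))

variable [Finite F] [MeasurableSingletonClass F]

instance (hM : 2 ≤ M) (π : Measure F) [IsProbabilityMeasure π] (s : F → ℤ → X) :
    IsProbabilityMeasure (phaseLaw hM π s) :=
  Measure.isProbabilityMeasure_map (measurable_of_countable _).aemeasurable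

theorem fst_pairPhaseLaw (hM : 2 ≤ M) (π : Measure F) (s t : F → ℤ → X) :
    (pairPhaseLaw hM π s t).fst = phaseLaw hM π s := by
  rw [pairPhaseLaw, Measure.fst, Measure.map_map measurable_fst (measurable_of_countable _)]
  rfl

theorem snd_pairPhaseLaw (hM : 2 ≤ M) (π : Measure F) (s t : F → ℤ → X) :
    (pairPhaseLaw hM π s t).snd = phaseLaw hM π t := by
  rw [pairPhaseLaw, Measure.snd, Measure.map_map measurable_snd (measurable_of_countable _)]
  rfl

theorem phaseLaw_prod_phaseLaw (hM : 2 ≤ M) {F' : Type*} [MeasurableSpace F'] [Finite F']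
    [MeasurableSingletonClass F'] (π : Measure F) [IsProbabilityMeasure π] (π' : Measure F')
    [IsProbabilityMeasure π'] (s : F → ℤ → X) (t : F' → ℤ → X) :
    (phaseLaw hM π s).prod (phaseLaw hM π' t) =
      pairPhaseLaw hM (π.prod π') (fun f => s f.1) (fun f => t f.2) := by
  rw [phaseLaw, phaseLaw, Measure.map_prod_map _ _ (measurable_of_countable _)
    (measurable_of_countable _)]
  rfl

instance (hM : 2 ≤ M) (π : Measure F) [IsProbabilityMeasure π] (s t : F → ℤ → X) :
    IsProbabilityMeasure (pairPhaseLaw hM π s t) :=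
  Measure.isProbabilityMeasure_map (measurable_of_countable _).aemeasurable

theorem ae_mem_phaseLaw [Countable X] [Nonempty X] {U : Set (RootedNetwork X M)}
    (hU : ∀ x : RootedNetwork X M, x.IsPath → x ∈ U) (hM : 2 ≤ M) (π : Measure F)
    (s : F → ℤ → X) : ∀ᵐ x ∂(phaseLaw hM π s), x ∈ U := by
  -- `U` need not be measurable, but it contains a measurable set of full measure
  let V : Set (RootedNetwork X M) := ⋃ f, ⋂ r : ℕ, {x | (x.toNet.induce (x.toNet.ball x.root r)).Iso
    ((pathNetwork hM (s f)).toNet.induce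
      ((pathNetwork hM (s f)).toNet.ball (pathNetwork hM (s f)).root r))
      (fun _ : Unit => x.root) (fun _ => (pathNetwork hM (s f)).root)}
  have hV : MeasurableSet V := MeasurableSet.iUnion fun f => MeasurableSet.iInter fun r =>
    RootedNetwork.measurableSet_of_ball r fun x y hxy hx => hxy.symm.trans hx
  have hVae : ∀ᵐ x ∂(phaseLaw hM π s), x ∈ V :=
    (ae_map_iff (measurable_of_countable _).aemeasurable hV).2
      (ae_of_all _ fun f => mem_iUnion.2 ⟨f, mem_iInter.2 fun r => Net.Iso.refl _ _⟩)
  filter_upwards [hVae] with x hx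
  obtain ⟨f, hf⟩ := mem_iUnion.1 hx
  exact hU x ((pathNetwork_isPath hM (s f)).of_iso_balls (mem_iInter.1 hf))

/-- The pair of paths with phase `f` and with walks, whose increments are coded by `ω`. -/
def pairPathWalk (hM : 2 ≤ M) (s t : F → ℤ → X) (p : F × (ℕ → Bool × Bool)) :
    WalkNetwork X M × WalkNetwork X M :=
  (pathWalk hM (s p.1) fun n => (p.2 n).1, pathWalk hM (t p.1) fun n => (p.2 n).2)

theorem measurable_pairPathWalk (hM : 2 ≤ M) (s t : F → ℤ → X) :
    Measurable (pairPathWalk hM s t) := by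
  refine measurable_from_prod_countable_right fun f => ?_
  exact ((measurable_pathWalk hM (s f)).comp (by fun_prop)).prodMk
    ((measurable_pathWalk hM (t f)).comp (by fun_prop))

theorem pairWithWalks_pairPhaseLaw [Countable X] [Nonempty X] (hM : 2 ≤ M) (π : Measure F)
    [IsProbabilityMeasure π] (s t : F → ℤ → X) : pairWithWalks (pairPhaseLaw hM π s t) =
      (π.prod (uniformSeq (Bool × Bool))).map (pairPathWalk hM s t) := by
  have hunzip : Measurable fun ω : ℕ → Bool × Bool =>
    ((fun n => (ω n).1, fun n => (ω n).2) : (ℕ → Bool) × (ℕ → Bool)) := by fun_prop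
  ext A hA
  rw [pairWithWalks, Measure.bind_apply hA
    RootedNetwork.measurable_walkLaw_prod.aemeasurable, pairPhaseLaw, lintegral_map
      (f := fun p : RootedNetwork X M × RootedNetwork X M => p.1.walkLaw.prod p.2.walkLaw A)
      ((Measure.measurable_coe hA).comp RootedNetwork.measurable_walkLaw_prod)
      (measurable_of_countable _), Measure.map_apply (measurable_pairPathWalk hM s t) hA,
    Measure.prod_apply (measurable_pairPathWalk hM s t hA)]
  refine lintegral_congr fun f => ?_
  rw [walkLaw_pathNetwork, walkLaw_pathNetwork, Measure.map_prod_map _ _ (measurable_pathWalk _ _)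
    (measurable_pathWalk _ _), ← map_uniformSeq_prod, Measure.map_map
      ((measurable_pathWalk _ _).prodMap (measurable_pathWalk _ _)) hunzip,
    Measure.map_apply (((measurable_pathWalk _ _).prodMap (measurable_pathWalk _ _)).comp hunzip) hA]
  rfl

theorem prod_mem_iff_of_iso {x x' y y' : WalkNetwork X M}
    (hx : x.toNet.Iso x'.toNet x.walk x'.walk) (hy : y.toNet.Iso y'.toNet y.walk y'.walk)
    {A : Set (WalkNetwork X M × WalkNetwork X M)} (hA : MeasurableSet A) :
    (x, y) ∈ A ↔ (x', y') ∈ A :=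
  (WalkNetwork.mem_iff_of_iso hx (A := {z | (z, y) ∈ A}) (measurable_prodMk_right hA)).trans
    (WalkNetwork.mem_iff_of_iso hy (A := {z | (x', z) ∈ A}) (measurable_prodMk_left hA))

/-- The pair of environments seen from the two walkers is a factor of a skew product over a
Bernoulli shift: a step of the walkers moves the phase by `τ`. -/
theorem pairPhaseLaw_mem_ergodicPairLaws [Countable X] [Nonempty X] {U : Set (RootedNetwork X M)}
    (hU : ∀ x : RootedNetwork X M, x.IsPath → x ∈ U) (hM : 2 ≤ M) (π : Measure F)
    [IsProbabilityMeasure π] (s t : F → ℤ → X) (τ : Bool × Bool → F → F)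
    (hs : ∀ b f z, s (τ b f) z = s f (z + bitStep b.1))
    (ht : ∀ b f z, t (τ b f) z = t f (z + bitStep b.2))
    (hτ : ∀ b, MeasurePreserving (τ b) π π)
    (htrans : ∀ f f', Relation.ReflTransGen (fun a b => ∃ e, b = τ e a) f f') :
    pairPhaseLaw hM π s t ∈ ergodicPairLaws U := by
  have hΨ := measurable_pairPathWalk hM s t
  have hshift : Measurable (Prod.map WalkNetwork.shift WalkNetwork.shift :
      WalkNetwork X M × WalkNetwork X M → _) :=
    WalkNetwork.measurable_shift.prodMap WalkNetwork.measurable_shift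
  have hcomm : ∀ {A : Set (WalkNetwork X M × WalkNetwork X M)}, MeasurableSet A →
      ∀ f (ω : ℕ → Bool × Bool),
      Prod.map WalkNetwork.shift WalkNetwork.shift (pairPathWalk hM s t (f, ω)) ∈ A ↔
        pairPathWalk hM s t (τ (ω 0) f, fun n => ω (n + 1)) ∈ A := by
    intro A hA f ω
    refine prod_mem_iff_of_iso ?_ ?_ hA
    · convert! iso_shift_pathWalk hM (s f) fun n => (ω n).1 using 3
      · exact funext (hs (ω 0) f)
      · exact funext (hs (ω 0) f)
    · convert! iso_shift_pathWalk hM (t f) fun n => (ω n).2 using 3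
      · exact funext (ht (ω 0) f)
      · exact funext (ht (ω 0) f)
  refine ⟨inferInstance, ?_, ?_⟩
  · rw [pairWithWalks_pairPhaseLaw]
    refine ⟨⟨hshift, ?_⟩, ⟨fun A hA hinv => ?_⟩⟩
    · ext A hA
      rw [Measure.map_apply hshift hA, Measure.map_apply hΨ (hshift hA), Measure.map_apply hΨ hA,
        ← prod_uniformSeq_preimage_skewProduct hτ (hΨ hA)]
      congr 1
      ext p
      exact hcomm hA p.1 p.2
    · have h01 : π.prod (uniformSeq (Bool × Bool)) (pairPathWalk hM s t ⁻¹' A) = 0 ∨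
          π.prod (uniformSeq (Bool × Bool)) (pairPathWalk hM s t ⁻¹' A) = 1 := by
        refine prod_uniformSeq_eq_zero_or_one htrans (hΨ hA) fun f ω => ?_
        have : Prod.map WalkNetwork.shift WalkNetwork.shift (pairPathWalk hM s t (f, ω)) ∈ A ↔
            pairPathWalk hM s t (f, ω) ∈ A := Set.ext_iff.1 hinv _
        exact (hcomm hA f ω).symm.trans this
      rw [← Measure.map_apply hΨ hA] at h01
      have : IsProbabilityMeasure ((π.prod (uniformSeq (Bool × Bool))).map (pairPathWalk hM s t)) :=
        Measure.isProbabilityMeasure_map hΨ.aemeasurable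
      refine eventuallyConst_set.2 (h01.symm.imp (fun h => ?_) fun h => ?_)
      · exact (prob_compl_eq_zero_iff hA).2 h
      · exact measure_eq_zero_iff_ae_notMem.1 h
  · have h1 := ae_mem_phaseLaw hU hM π s
    have h2 := ae_mem_phaseLaw hU hM π t
    rw [← fst_pairPhaseLaw hM π s t] at h1
    rw [← snd_pairPhaseLaw hM π s t] at h2
    filter_upwards [ae_of_ae_map measurable_fst.aemeasurable h1,
      ae_of_ae_map measurable_snd.aemeasurable h2] with p hp1 hp2
    exact ⟨hp1, hp2⟩

end Phases

/-! ### Tests cannot tell long periodic patterns from their limits -/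

section Tests

variable {X : Type*} {M : ℕ} [Countable X] [Nonempty X]

/-- No measurability of the sets `D n` is needed: measures are continuous along increasing sequences
of arbitrary sets. -/
theorem exists_measure_gt_of_ae_eventually {Ω : Type*} [MeasurableSpace Ω] {P : Measure Ω}
    [IsProbabilityMeasure P] {D : ℕ → Set Ω} (h : ∀ᵐ ω ∂P, ∀ᶠ n in atTop, ω ∈ D n)
    {c : ENNReal} (hc : c < 1) : ∃ n, 1 ≤ n ∧ c < P (D n) := by
  have hmono : Monotone fun N => ⋂ n ∈ Set.Ici N, D n := fun N N' hN =>
    biInter_subset_biInter_left (Set.Ici_subset_Ici.2 hN)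
  have huniv : P (⋃ N, ⋂ n ∈ Set.Ici N, D n) = 1 := by
    rw [← measure_univ (μ := P)]
    refine measure_congr ?_
    filter_upwards [h] with ω hω
    refine eq_true ?_ |>.trans (eq_true trivial).symm
    obtain ⟨N, hN⟩ := eventually_atTop.1 hω
    exact mem_iUnion.2 ⟨N, mem_iInter₂.2 hN⟩
  rw [hmono.measure_iUnion] at huniv
  obtain ⟨N, hN⟩ := lt_iSup_iff.1 (huniv ▸ hc)
  exact ⟨max N 1, le_max_right _ _, hN.trans_le (measure_mono
    (biInter_subset_of_mem (le_max_left N 1)))⟩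

/-- If some law of the alternative has a phase with marks `a` and `b` on the two paths, and if laws
of the hypothesis, with probability bounded below, look on arbitrarily large windows like these
marks, then no test is consistent. -/
theorem PairTest.not_isConsistent_of_phases (hM : 2 ≤ M) (ψ : PairTest X) (k : ℕ → ℕ)
    {H₀ H₁ : Set (Measure (RootedNetwork X M × RootedNetwork X M))} {a b : ℤ → X}
    {F : Type*} [MeasurableSpace F] [Finite F] [MeasurableSingletonClass F] {π : Measure F}
    [IsProbabilityMeasure π] {s t : F → ℤ → X} {f : F} (hf : π {f} ≠ 0) (hs : s f = a)
    (ht : t f = b) (h₁ : pairPhaseLaw hM π s t ∈ H₁)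
    (h₀ : ∀ R : ℕ, ∃ (F' : Type) (_ : MeasurableSpace F') (_ : Finite F')
      (_ : MeasurableSingletonClass F') (π' : Measure F') (_ : IsProbabilityMeasure π')
      (s' t' : F' → ℤ → X), pairPhaseLaw hM π' s' t' ∈ H₀ ∧
      16⁻¹ ≤ π' {g | ∀ z : ℤ, |z| ≤ R → s' g z = a z ∧ t' g z = b z}) :
    ¬ ψ.IsConsistent k H₀ H₁ := by
  intro hψ
  -- under laws of the hypothesis the test will reject with probability at least `16⁻¹ * 2⁻¹`, so
  -- the level `64⁻¹` is violated
  have hα : (64⁻¹ : ℝ) ∈ Ioo (0 : ℝ) 1 := by constructor <;> norm_num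
  have hII := hψ.typeII _ h₁ _ hα
  rw [pairWithWalks_pairPhaseLaw] at hII
  have hII' := Measure.ae_ae_of_ae_prod
    (ae_of_ae_map (measurable_pairPathWalk hM s t).aemeasurable hII)
  have hlim : ∀ᵐ ω ∂(uniformSeq (Bool × Bool)), ∀ᶠ n in atTop,
      ω ∈ {ω | ψ.answer 64⁻¹ n ((pathWalk hM a fun n => (ω n).1).sample k n)
        ((pathWalk hM b fun n => (ω n).2).sample k n) = true} := by
    by_contra hbad
    refine hf (measure_mono_null ?_ (ae_iff.1 hII'))
    rintro g rfl
    subst hs ht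
    exact hbad
  obtain ⟨n, hn, hD⟩ := exists_measure_gt_of_ae_eventually hlim ENNReal.one_half_lt_one
  obtain ⟨F', _, _, _, π', _, s', t', hρ, hgood⟩ := h₀ (n + k n)
  have hI := hψ.typeI _ hρ n hn _ hα
  rw [pairWithWalks_pairPhaseLaw] at hI
  have hle := (Measure.le_map_apply (measurable_pairPathWalk hM s' t').aemeasurable _).trans hI
  have hsub : {g | ∀ z : ℤ, |z| ≤ ((n + k n : ℕ) : ℤ) → s' g z = a z ∧ t' g z = b z} ×ˢ
      {ω | ψ.answer 64⁻¹ n ((pathWalk hM a fun n => (ω n).1).sample k n)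
        ((pathWalk hM b fun n => (ω n).2).sample k n) = true} ⊆
      pairPathWalk hM s' t' ⁻¹' {p | ψ.answer 64⁻¹ n (p.1.sample k n) (p.2.sample k n) = true} := by
    rintro ⟨g, ω⟩ ⟨hg, hω⟩
    refine (ψ.invariant _ _ _ _ _ _ ?_ ?_).trans hω
    · exact iso_sample_pathWalk hM k n (fun z hz => (hg z (by exact_mod_cast hz)).1) _
    · exact iso_sample_pathWalk hM k n (fun z hz => (hg z (by exact_mod_cast hz)).2) _
  have h := (measure_mono hsub).trans hle
  rw [Measure.prod_prod] at h
  have h2 : (16⁻¹ * 2⁻¹ : ENNReal) ≤ ENNReal.ofReal 64⁻¹ := by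
    refine le_trans ?_ h
    exact mul_le_mul' hgood hD.le
  rw [show (16⁻¹ * 2⁻¹ : ENNReal) = ENNReal.ofReal 32⁻¹ by
    rw [← ENNReal.mul_inv (by simp) (by simp), ENNReal.ofReal_inv_of_pos (by norm_num)]
    norm_num, ENNReal.ofReal_le_ofReal_iff (by norm_num)] at h2
  norm_num at h2

end Tests

/-! ### Periodic marks with a uniform phase -/

section Cyclic

variable {X : Type*} {M : ℕ}

/-- The uniform law of a phase. -/
noncomputable def uniformPhase (F : Type*) [Fintype F] [Nonempty F] [MeasurableSpace F] :
    Measure F := (PMF.uniformOfFintype F).toMeasure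

instance (F : Type*) [Fintype F] [Nonempty F] [MeasurableSpace F] :
    IsProbabilityMeasure (uniformPhase F) := PMF.toMeasure.isProbabilityMeasure _

theorem uniformPhase_singleton {F : Type*} [Fintype F] [Nonempty F] [MeasurableSpace F]
    [MeasurableSingletonClass F] (f : F) : uniformPhase F {f} = (Fintype.card F : ENNReal)⁻¹ := by
  rw [uniformPhase, PMF.toMeasure_apply_singleton _ _ (measurableSet_singleton _),
    PMF.uniformOfFintype_apply]

theorem measurePreserving_uniformPhase {F : Type*} [Fintype F] [Nonempty F] [MeasurableSpace F]
    [MeasurableSingletonClass F] (e : F ≃ F) :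
    MeasurePreserving e (uniformPhase F) (uniformPhase F) := by
  refine ⟨measurable_of_countable _, Measure.ext_of_singleton fun f => ?_⟩
  rw [Measure.map_apply (measurable_of_countable _) (measurableSet_singleton _),
    uniformPhase_singleton, ← uniformPhase_singleton (e.symm f)]
  congr 1
  ext g
  simp [Equiv.eq_symm_apply]

/-- The marks on the integers that repeat the pattern `c 0, …, c (N - 1)`, starting at the
phase `i`. -/
def cyclicMarks (N : ℕ) (c : ℕ → X) (i : ZMod N) (z : ℤ) : X := c (i + z : ZMod N).val

/-- The law of the bi-infinite path with periodic marks and a uniform phase. -/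
noncomputable def cyclicLaw (hM : 2 ≤ M) (N : ℕ) [NeZero N] (c : ℕ → X) :
    Measure (RootedNetwork X M) := phaseLaw hM (uniformPhase (ZMod N)) (cyclicMarks N c)

/-- The pair of walks can move the pair of phases in the directions `(1, 1)` and `(1, -1)`, which
generate everything if the period is odd. -/
theorem reflTransGen_zmod_prod {N : ℕ} [NeZero N] (hN : Odd N) (f f' : ZMod N × ZMod N) :
    Relation.ReflTransGen (fun a b => ∃ e : Bool × Bool,
      b = (a.1 + (bitStep e.1 : ZMod N), a.2 + (bitStep e.2 : ZMod N))) f f' := by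
  have h1 : ∀ (n : ℕ) (f : ZMod N × ZMod N), Relation.ReflTransGen (fun a b => ∃ e : Bool × Bool,
      b = (a.1 + (bitStep e.1 : ZMod N), a.2 + (bitStep e.2 : ZMod N))) f (f.1 + n, f.2 + n) := by
    intro n f
    induction n with
    | zero => simpa using Relation.ReflTransGen.refl
    | succ n ih => exact ih.tail ⟨(true, true), by simp [bitStep, add_assoc]⟩
  have h2 : ∀ (n : ℕ) (f : ZMod N × ZMod N), Relation.ReflTransGen (fun a b => ∃ e : Bool × Bool,
      b = (a.1 + (bitStep e.1 : ZMod N), a.2 + (bitStep e.2 : ZMod N))) f (f.1 + n, f.2 - n) := by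
    intro n f
    induction n with
    | zero => simpa using Relation.ReflTransGen.refl
    | succ n ih =>
      refine ih.tail ⟨(true, false), ?_⟩
      simp only [bitStep, if_true, Bool.false_eq_true, if_false, Prod.mk.injEq]
      push_cast
      constructor <;> ring
  obtain ⟨m, hm⟩ := hN
  have hhalf : (2 : ZMod N) * (m + 1) = 1 := by
    have : ((2 * m + 1 : ℕ) : ZMod N) = 0 := by rw [← hm]; exact ZMod.natCast_self N
    push_cast at this
    linear_combination this
  have := (h1 (((f'.1 - f.1) + (f'.2 - f.2)) * (m + 1) : ZMod N).val f).trans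
    (h2 (((f'.1 - f.1) - (f'.2 - f.2)) * (m + 1) : ZMod N).val _)
  simp only [ZMod.natCast_val, ZMod.cast_id', id] at this
  convert! this using 1
  refine Prod.ext ?_ ?_
  · simp only
    linear_combination (f.1 - f'.1) * hhalf
  · simp only
    linear_combination (f.2 - f'.2) * hhalf

instance (hM : 2 ≤ M) (N : ℕ) [NeZero N] (c : ℕ → X) : IsProbabilityMeasure (cyclicLaw hM N c) :=
  inferInstanceAs (IsProbabilityMeasure (phaseLaw hM _ _))

theorem cyclicLaw_prod (hM : 2 ≤ M) (N : ℕ) [NeZero N] (c : ℕ → X) :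
    (cyclicLaw hM N c).prod (cyclicLaw hM N c) =
      pairPhaseLaw hM ((uniformPhase (ZMod N)).prod (uniformPhase (ZMod N)))
        (fun f => cyclicMarks N c f.1) (fun f => cyclicMarks N c f.2) :=
  phaseLaw_prod_phaseLaw hM _ _ _ _

/-- A lower bound for the probability that the marks around the root look like `a`: the good phases
`v 0, …, v (q - 1)` are at least a quarter of all phases. -/
theorem inv_four_le_uniformPhase {N q R : ℕ} [NeZero N] {c : ℕ → X} {a : ℤ → X} {v : ℕ → ℕ}
    (hq : N ≤ 4 * q) (hv : Function.Injective v) (hvR : ∀ j < q, R ≤ v j ∧ v j + R < N)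
    (hc : ∀ j < q, ∀ z : ℤ, |z| ≤ R → c (v j + z).toNat = a z) :
    4⁻¹ ≤ uniformPhase (ZMod N) {i | ∀ z : ℤ, |z| ≤ R → cyclicMarks N c i z = a z} := by
  have hval : ∀ m < N, (m : ZMod N).val = m := fun m hm => ZMod.val_natCast_of_lt hm
  let T : Finset (ZMod N) := (Finset.range q).image fun j => (v j : ZMod N)
  have hT : T.card = q := by
    rw [Finset.card_image_of_injOn, Finset.card_range]
    intro i hi j hj hij
    have hi := (hvR i (by simpa using hi)).2
    have hj := (hvR j (by simpa using hj)).2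
    have := congrArg ZMod.val hij
    simp only at this
    rw [hval _ (by omega), hval _ (by omega)] at this
    exact hv this
  have hsub : (T : Set (ZMod N)) ⊆ {i | ∀ z : ℤ, |z| ≤ R → cyclicMarks N c i z = a z} := by
    intro i hi z hz
    obtain ⟨j, hj, rfl⟩ := Finset.mem_image.1 (Finset.mem_coe.1 hi)
    have hj := Finset.mem_range.1 hj
    obtain ⟨h1, h2⟩ := hvR j hj
    have hz' := abs_le.1 hz
    rw [← hc j hj z hz, cyclicMarks, ← hval (v j + z).toNat (by omega)]
    congr 2
    have : (((v j + z).toNat : ℤ) : ZMod N) = ((v j + z : ℤ) : ZMod N) := by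
      rw [Int.toNat_of_nonneg (by omega)]
    push_cast at this
    exact this.symm
  refine le_trans ?_ (measure_mono hsub)
  rw [uniformPhase, PMF.toMeasure_apply_finset]
  simp only [PMF.uniformOfFintype_apply, Finset.sum_const, hT, ZMod.card, nsmul_eq_mul]
  have hN : (N : ENNReal) ≠ 0 := by exact_mod_cast NeZero.ne N
  rw [← div_eq_mul_inv, ENNReal.le_div_iff_mul_le (Or.inl hN) (Or.inl (by simp)), mul_comm,
    ← div_eq_mul_inv]
  refine ENNReal.div_le_of_le_mul ?_
  rw [mul_comm]
  exact_mod_cast hq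

variable [Countable X] [Nonempty X]

theorem cyclicLaw_prod_mem_ergodicPairLaws {U : Set (RootedNetwork X M)}
    (hU : ∀ x : RootedNetwork X M, x.IsPath → x ∈ U) (hM : 2 ≤ M) {N : ℕ} [NeZero N] (hN : Odd N)
    (c : ℕ → X) : (cyclicLaw hM N c).prod (cyclicLaw hM N c) ∈ ergodicPairLaws U := by
  rw [cyclicLaw_prod]
  refine pairPhaseLaw_mem_ergodicPairLaws hU hM _ _ _
    (fun b f => (f.1 + (bitStep b.1 : ZMod N), f.2 + (bitStep b.2 : ZMod N))) ?_ ?_ ?_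
    (reflTransGen_zmod_prod hN)
  · intro b f z
    simp only [cyclicMarks]
    push_cast
    congr 2
    ring
  · intro b f z
    simp only [cyclicMarks]
    push_cast
    congr 2
    ring
  · intro b
    exact (measurePreserving_uniformPhase (Equiv.addRight _)).prod
      (measurePreserving_uniformPhase (Equiv.addRight _))

theorem cyclicLaw_mem_ergodicLaws {U : Set (RootedNetwork X M)}
    (hU : ∀ x : RootedNetwork X M, x.IsPath → x ∈ U) (hM : 2 ≤ M) {N : ℕ} [NeZero N] (hN : Odd N)
    (c : ℕ → X) : cyclicLaw hM N c ∈ ergodicLaws U := by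
  have := fst_mem_ergodicLaws (cyclicLaw_prod_mem_ergodicPairLaws hU hM hN c)
  rw [Measure.fst_prod] at this
  exact this (ae_mem_phaseLaw hU hM _ _)

end Cyclic

/-! ### Laws that tests would have to tell apart -/

section Alternatives

variable {X : Type*} {M : ℕ}

theorem inv_sixteen_le_uniformPhase_prod {N q R : ℕ} [NeZero N] {c : ℕ → X} {a b : ℤ → X}
    {v w : ℕ → ℕ} (hq : N ≤ 4 * q) (hv : Function.Injective v)
    (hvR : ∀ j < q, R ≤ v j ∧ v j + R < N)
    (hvc : ∀ j < q, ∀ z : ℤ, |z| ≤ R → c (v j + z).toNat = a z) (hw : Function.Injective w)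
    (hwR : ∀ j < q, R ≤ w j ∧ w j + R < N)
    (hwc : ∀ j < q, ∀ z : ℤ, |z| ≤ R → c (w j + z).toNat = b z) :
    16⁻¹ ≤ ((uniformPhase (ZMod N)).prod (uniformPhase (ZMod N))) {f | ∀ z : ℤ, |z| ≤ R →
      cyclicMarks N c f.1 z = a z ∧ cyclicMarks N c f.2 z = b z} := by
  have hsub : {i | ∀ z : ℤ, |z| ≤ R → cyclicMarks N c i z = a z} ×ˢ
      {i | ∀ z : ℤ, |z| ≤ R → cyclicMarks N c i z = b z} ⊆ {f : ZMod N × ZMod N |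
        ∀ z : ℤ, |z| ≤ R → cyclicMarks N c f.1 z = a z ∧ cyclicMarks N c f.2 z = b z} :=
    fun f hf z hz => ⟨hf.1 z hz, hf.2 z hz⟩
  refine le_trans ?_ (measure_mono hsub)
  rw [Measure.prod_prod]
  refine le_trans (le_of_eq ?_) (mul_le_mul' (inv_four_le_uniformPhase hq hv hvR hvc)
    (inv_four_le_uniformPhase hq hw hwR hwc))
  rw [← ENNReal.mul_inv (by simp) (by simp)]
  norm_num

/-- The law of the path with constant marks. -/
noncomputable def constLaw (hM : 2 ≤ M) (x : X) : Measure (RootedNetwork X M) :=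
  phaseLaw hM (uniformPhase Unit) fun _ _ => x

instance (hM : 2 ≤ M) (x : X) : IsProbabilityMeasure (constLaw hM x) :=
  inferInstanceAs (IsProbabilityMeasure (phaseLaw hM _ _))

theorem constLaw_prod (hM : 2 ≤ M) (x y : X) : (constLaw hM x).prod (constLaw hM y) =
    pairPhaseLaw hM ((uniformPhase Unit).prod (uniformPhase Unit)) (fun _ _ => x) fun _ _ => y :=
  phaseLaw_prod_phaseLaw hM _ _ _ _

/-- The mark at `z` of the path with alternating marks `x, y`; the mark at `0` is `x` if `i` is
`true`, and `y` otherwise. -/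
def alternatingMarks (x y : X) (i : Bool) (z : ℤ) : X := if (Even z ↔ i = true) then x else y

theorem alternatingMarks_not (x y : X) (i b : Bool) (z : ℤ) :
    alternatingMarks x y (!i) z = alternatingMarks x y i (z + bitStep b) := by
  have : Even (z + bitStep b) ↔ ¬ Even z := by
    cases b <;> simp [bitStep, parity_simps]
  unfold alternatingMarks
  refine if_congr ?_ rfl rfl
  rw [this]
  cases i <;> simp

variable [Countable X] [Nonempty X]

theorem constLaw_prod_mem_ergodicPairLaws {U : Set (RootedNetwork X M)}
    (hU : ∀ x : RootedNetwork X M, x.IsPath → x ∈ U) (hM : 2 ≤ M) (x y : X) :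
    (constLaw hM x).prod (constLaw hM y) ∈ ergodicPairLaws U := by
  rw [constLaw_prod]
  exact pairPhaseLaw_mem_ergodicPairLaws hU hM _ _ _ (fun _ f => f) (fun _ _ _ => rfl)
    (fun _ _ _ => rfl) (fun _ => MeasurePreserving.id _) fun a b => by
      rw [Subsingleton.elim a b]

theorem constLaw_mem_ergodicLaws {U : Set (RootedNetwork X M)}
    (hU : ∀ x : RootedNetwork X M, x.IsPath → x ∈ U) (hM : 2 ≤ M) (x : X) :
    constLaw hM x ∈ ergodicLaws U := by
  have := fst_mem_ergodicLaws (constLaw_prod_mem_ergodicPairLaws hU hM x x)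
  rw [Measure.fst_prod] at this
  exact this (ae_mem_phaseLaw hU hM _ _)

theorem measurableSet_mark_root (x : X) :
    MeasurableSet {y : RootedNetwork X M | y.mark y.root = x} := by
  refine RootedNetwork.measurableSet_of_ball 0 ?_
  rintro y y' ⟨f, -, h2, h3⟩ h
  have hr : y.root ∈ (y.toNet.induce (y.toNet.ball y.root 0)).verts :=
    ⟨y.root_mem, Net.self_mem_ball y.root_mem 0⟩
  have h4 : (f ⟨_, hr⟩ : ℕ) = y'.root := (h3 ⟨_, hr⟩ ()).1 rfl
  change y'.mark y'.root = x
  rw [← h4, ← h]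
  exact (h2 ⟨_, hr⟩).symm

theorem phaseLaw_mark_root {F : Type*} [MeasurableSpace F] [Finite F] [MeasurableSingletonClass F]
    (hM : 2 ≤ M) (π : Measure F) (s : F → ℤ → X) (x : X) :
    phaseLaw hM π s {y | y.mark y.root = x} = π {f | s f 0 = x} := by
  rw [phaseLaw, Measure.map_apply (measurable_of_countable _) (measurableSet_mark_root x)]
  congr 1
  ext f
  simp [pathNetwork, pathNet]

theorem constLaw_injective (hM : 2 ≤ M) :
    Function.Injective (constLaw hM : X → Measure (RootedNetwork X M)) := by
  intro x y h
  by_contra hne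
  have := congrArg (fun m => m {z : RootedNetwork X M | z.mark z.root = x}) h
  simp [constLaw, phaseLaw_mark_root, Ne.symm hne] at this

theorem alternating_mem_ergodicPairLaws {U : Set (RootedNetwork X M)}
    (hU : ∀ x : RootedNetwork X M, x.IsPath → x ∈ U) (hM : 2 ≤ M) (x y : X) :
    pairPhaseLaw hM (uniformPhase Bool) (alternatingMarks x y) (alternatingMarks x y) ∈
      ergodicPairLaws U := by
  refine pairPhaseLaw_mem_ergodicPairLaws hU hM _ _ _ (fun _ f => !f)
    (fun b f z => alternatingMarks_not x y f b.1 z) (fun b f z => alternatingMarks_not x y f b.2 z)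
    (fun _ => measurePreserving_uniformPhase Equiv.boolNot) fun f f' => ?_
  by_cases h : f' = f
  · rw [h]
  · exact Relation.ReflTransGen.single ⟨(true, true), Bool.eq_not.2 h⟩

/-- Two alternating paths with the same uniform phase are not independent. -/
theorem alternating_ne_prod (hM : 2 ≤ M) {x y : X} (hxy : x ≠ y) :
    pairPhaseLaw hM (uniformPhase Bool) (alternatingMarks x y) (alternatingMarks x y) ≠
      (pairPhaseLaw hM (uniformPhase Bool) (alternatingMarks x y) (alternatingMarks x y)).fst.prod
        (pairPhaseLaw hM (uniformPhase Bool) (alternatingMarks x y) (alternatingMarks x y)).snd := by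
  intro h
  have hm := measurableSet_mark_root (M := M) x
  have hset : {f | alternatingMarks x y f 0 = x} = {true} := by
    ext f
    cases f <;> simp [alternatingMarks, hxy.symm]
  have hl : pairPhaseLaw hM (uniformPhase Bool) (alternatingMarks x y) (alternatingMarks x y)
      ({z | z.mark z.root = x} ×ˢ {z | z.mark z.root = x}) = 2⁻¹ := by
    rw [pairPhaseLaw, Measure.map_apply (measurable_of_countable _) (hm.prod hm)]
    have : (fun f => (pathNetwork hM (alternatingMarks x y f),
        pathNetwork hM (alternatingMarks x y f))) ⁻¹' ({z | z.mark z.root = x} ×ˢ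
          {z | z.mark z.root = x}) = {true} := by
      rw [← hset]
      ext f
      simp [pathNetwork, pathNet]
    rw [this, uniformPhase_singleton]
    simp
  rw [h, fst_pairPhaseLaw, snd_pairPhaseLaw, Measure.prod_prod, phaseLaw_mark_root, hset,
    uniformPhase_singleton, Fintype.card_bool, Nat.cast_ofNat] at hl
  rw [← ENNReal.mul_inv (by simp) (by simp), inv_inj] at hl
  norm_num at hl

/-- Mark the first half of a long period with `x` and the second half with `y`. Seen from a random
phase, the network looks like a path with constant marks `x` or like one with constant marks `y`;
for two independent copies, these are different with probability about one half. -/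
theorem PairTest.not_isConsistent_homogeneity (hM : 2 ≤ M) (ψ : PairTest X) (k : ℕ → ℕ)
    {H₀ H₁ : Set (Measure (RootedNetwork X M × RootedNetwork X M))} (x y : X)
    (h₁ : (constLaw hM x).prod (constLaw hM y) ∈ H₁)
    (h₀ : ∀ (N : ℕ) (_ : NeZero N), Odd N → ∀ c : ℕ → X,
      (cyclicLaw hM N c).prod (cyclicLaw hM N c) ∈ H₀) : ¬ ψ.IsConsistent k H₀ H₁ := by
  rw [constLaw_prod] at h₁
  refine ψ.not_isConsistent_of_phases hM k (f := ((), ())) ?_ rfl rfl h₁ fun R => ?_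
  · rw [← singleton_prod_singleton, Measure.prod_prod, uniformPhase_singleton]
    simp
  · -- the windows of radius `R` around the phases `R, …, 3 * R` see only the mark `x`, those around
    -- the phases `5 * R + 1, …, 7 * R + 1` see only the mark `y`
    have hN : NeZero (8 * R + 3) := ⟨by omega⟩
    have h := h₀ (8 * R + 3) hN ⟨4 * R + 1, by ring⟩ fun j => if j < 4 * R + 1 then x else y
    rw [cyclicLaw_prod] at h
    refine ⟨_, _, inferInstance, inferInstance, _, inferInstance, _, _, h, ?_⟩
    refine inv_sixteen_le_uniformPhase_prod (q := 2 * R + 1) (v := fun j => R + j)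
      (w := fun j => 5 * R + 1 + j) (by omega) (fun i j hij => by simpa using hij) (by omega) ?_
      (fun i j hij => by simpa using hij) (by omega) ?_
    · intro j hj z hz
      rw [abs_le] at hz
      exact if_pos (by push_cast; omega)
    · intro j hj z hz
      rw [abs_le] at hz
      exact if_neg (by push_cast; omega)

/-- In an alternating pattern with a long odd period, two equal marks are adjacent only at one defect
per period. So two independent copies look like two alternating paths, either with equal phases or
with opposite ones, and neither of these two cases is a pair of independent networks; but the
product law itself is ergodic, because the odd period makes the walks aperiodic. -/
theorem PairTest.not_isConsistent_independence (hM : 2 ≤ M) (ψ : PairTest X) (k : ℕ → ℕ)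
    {H₀ H₁ : Set (Measure (RootedNetwork X M × RootedNetwork X M))} (x y : X)
    (h₁ : pairPhaseLaw hM (uniformPhase Bool) (alternatingMarks x y) (alternatingMarks x y) ∈ H₁)
    (h₀ : ∀ (N : ℕ) (_ : NeZero N), Odd N → ∀ c : ℕ → X,
      (cyclicLaw hM N c).prod (cyclicLaw hM N c) ∈ H₀) : ¬ ψ.IsConsistent k H₀ H₁ := by
  refine ψ.not_isConsistent_of_phases hM k (f := true) ?_ rfl rfl h₁ fun R => ?_
  · rw [uniformPhase_singleton]
    simp
  · -- the windows of radius `R` around the even phases from `2 * R` to `6 * R` avoid the defect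
    have hN : NeZero (8 * R + 3) := ⟨by omega⟩
    have h := h₀ (8 * R + 3) hN ⟨4 * R + 1, by ring⟩ fun j => if Even j then x else y
    rw [cyclicLaw_prod] at h
    refine ⟨_, _, inferInstance, inferInstance, _, inferInstance, _, _, h, ?_⟩
    have hc : ∀ j < 2 * R + 1, ∀ z : ℤ, |z| ≤ R →
        (if Even (((2 * (R + j) : ℕ) : ℤ) + z).toNat then x else y) =
          alternatingMarks x y true z := by
      intro j hj z hz
      rw [abs_le] at hz
      refine if_congr ?_ rfl rfl
      rw [← Int.even_coe_nat, Int.toNat_of_nonneg (by push_cast; omega)]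
      simp [parity_simps]
    exact inv_sixteen_le_uniformPhase_prod (q := 2 * R + 1) (v := fun j => 2 * (R + j))
      (w := fun j => 2 * (R + j)) (by omega) (fun i j hij => by simpa using hij) (by omega) hc
      (fun i j hij => by simpa using hij) (by omega) hc

end Alternatives

theorem mainTheorem4 {X : Type*} [Finite X] [Nontrivial X] (M : ℕ) (hM : 2 ≤ M)
    (k : ℕ → ℕ) (hk : Monotone k) (hk' : Tendsto k atTop atTop)
    (U : Set (RootedNetwork X M)) (hU : ∀ x : RootedNetwork X M, x.IsPath → x ∈ U) :
    -- homogeneity of two independent random networks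
    (¬ ∃ ψ : PairTest X, ψ.IsConsistent k
      {ρ | ∃ μ ∈ ergodicLaws U, ρ = μ.prod μ}
      {ρ | ∃ μ ∈ ergodicLaws U, ∃ ν ∈ ergodicLaws U, μ ≠ ν ∧ ρ = μ.prod ν}) ∧
    -- homogeneity of two jointly distributed random networks
    (¬ ∃ ψ : PairTest X, ψ.IsConsistent k
      {ρ | ρ ∈ ergodicPairLaws U ∧ ρ.fst = ρ.snd}
      {ρ | ρ ∈ ergodicPairLaws U ∧ ρ.fst ≠ ρ.snd}) ∧
    -- independence
    (¬ ∃ ψ : PairTest X, ψ.IsConsistent k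
      {ρ | ρ ∈ ergodicPairLaws U ∧ ρ = ρ.fst.prod ρ.snd}
      {ρ | ρ ∈ ergodicPairLaws U ∧ ρ ≠ ρ.fst.prod ρ.snd}) := by
  obtain ⟨x, y, hxy⟩ := exists_pair_ne X
  refine ⟨?_, ?_, ?_⟩ <;> rintro ⟨ψ, hψ⟩
  · refine ψ.not_isConsistent_homogeneity hM k x y ?_ ?_ hψ
    · exact ⟨_, constLaw_mem_ergodicLaws hU hM x, _, constLaw_mem_ergodicLaws hU hM y,
        (constLaw_injective hM).ne hxy, rfl⟩
    · intro N _ hN c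
      exact ⟨_, cyclicLaw_mem_ergodicLaws hU hM hN c, rfl⟩
  · refine ψ.not_isConsistent_homogeneity hM k x y ?_ ?_ hψ
    · refine ⟨constLaw_prod_mem_ergodicPairLaws hU hM x y, ?_⟩
      rw [Measure.fst_prod, Measure.snd_prod]
      exact (constLaw_injective hM).ne hxy
    · intro N _ hN c
      refine ⟨cyclicLaw_prod_mem_ergodicPairLaws hU hM hN c, ?_⟩
      rw [Measure.fst_prod, Measure.snd_prod]
  · refine ψ.not_isConsistent_independence hM k x y ?_ ?_ hψ
    · exact ⟨alternating_mem_ergodicPairLaws hU hM x y, alternating_ne_prod hM hxy⟩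
    · intro N _ hN c
      refine ⟨cyclicLaw_prod_mem_ergodicPairLaws hU hM hN c, ?_⟩
      rw [Measure.fst_prod, Measure.snd_prod]
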